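/- For a permutation $\pi$ of $\{1,\dots,n\}$, the excedance word of $\pi$ is the word $w_1\cdots w_{n-1}$ in the letters $a,b$ with $w_i=b$ if $\pi(i)>i$ and $w_i=a$ if $\pi(i)\le i$. For integers $r\ge 1$ and $s\ge 0$, let $[b^{r-1}a^s]$ denote the number of permutations of $\{1,\dots,r+s\}$ whose excedance word consists of $r-1$ letters $b$ followed by $s$ letters $a$. Let $$f(t)=\frac{(1-e^{t})\log(1-e^{-t})}{t}\quad(t>0),\qquad \varepsilon_0=(e-1)\bigl(1-\log(e-1)\bigr),$$ $$Q(x,y)=xy\,e^{-x-y}\bigl[\,y e^{-y}+x e^{-x}-xy\,(e^{-y}+e^{-x})\bigr]\quad(x,y>0).$$ **Theorem.** The function $f$ is a bijection from $(0,\infty)$ onto $(0,\infty)$. For positive integers $r,s$ put $x=x(r,s)=f^{-1}(s/r)$ and $y=y(r,s)=f^{-1}(r/s)$. Then, uniformly as $r,s\to\infty$ with $\varepsilon_0\le s/r\le 1/\varepsilon_0$, $$[b^{r-1}a^s]=s!\,r!\,\bigl(e^{-y}+O(s^{-1/2})\bigr)\,\frac{1}{\sqrt{2\pi}}\;x^{-r}\,y^{-s}\,\sqrt{\frac{y\,e^{-y}}{s\,Q(x,y)}}.$$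 That is, there are absolute constants $C$ and $N$ such that for all integers $r,s\ge N$ with $r,s\geq 1$ and $\varepsilon_0\le s/r\le 1/\varepsilon_0$, the identity holds with the term $O(s^{-1/2})$ replaced by some real number $E=E(r,s)$ satisfying $|E|\le C s^{-1/2}$. -/

import Mathlib

namespace Excedance

/-- The two letters of excedance words. -/
inductive Letter : Type
  | a : Letter
  | b : Letter

/-- The excedance word of a permutation of `n = m + 1` points, a word of length `n - 1 = m`.
The points `1, …, n` are represented by `0, …, m` (a shift that does not affect comparisons):
the letter at `i` is `b` if `π i > i`, and `a` if `π i ≤ i`. -/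
def excedanceWord {m : ℕ} (π : Equiv.Perm (Fin (m + 1))) : Fin m → Letter :=
  fun i => if i.castSucc < π i.castSucc then Letter.b else Letter.a

/-- `[w]`: the number of permutations of `m + 1` points whose excedance word is `w`. -/
noncomputable def bracket {m : ℕ} (w : Fin m → Letter) : ℕ :=
  Nat.card {π : Equiv.Perm (Fin (m + 1)) // excedanceWord π = w}

/-- The word `b^r a^s`: first `r` letters `b`, then `s` letters `a`. -/
def baWord (r s : ℕ) : Fin (r + s) → Letter :=
  fun i => if (i : ℕ) < r then Letter.b else Letter.a

/-- `ε₀ = (e - 1) (1 - log (e - 1))`. -/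
noncomputable def eps0 : ℝ :=
  (Real.exp 1 - 1) * (1 - Real.log (Real.exp 1 - 1))

/-- The sector of pairs of positive integers `(r, s)` with `ε ≤ s / r ≤ 1 / ε`. -/
def sector (ε : ℝ) : Set (ℕ × ℕ) :=
  {p | 0 < p.1 ∧ 0 < p.2 ∧ ε ≤ (p.2 : ℝ) / (p.1 : ℝ) ∧ (p.2 : ℝ) / (p.1 : ℝ) ≤ 1 / ε}

/-- `f(t) = (1 - e^t) log (1 - e^{-t}) / t`, used for `t > 0`. -/
noncomputable def f (t : ℝ) : ℝ :=
  (1 - Real.exp t) * Real.log (1 - Real.exp (-t)) / t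

/-- The inverse of `f`, regarded as a function from `(0, ∞)` to `(0, ∞)`. -/
noncomputable def fInv : ℝ → ℝ :=
  Function.invFunOn f (Set.Ioi 0)

/-- `x(r, s) = f⁻¹(s / r)`. -/
noncomputable def x (r s : ℕ) : ℝ := fInv ((s : ℝ) / (r : ℝ))

/-- `y(r, s) = f⁻¹(r / s)`. -/
noncomputable def y (r s : ℕ) : ℝ := fInv ((r : ℝ) / (s : ℝ))

/-- `Q(x, y) = x y e^{-x-y} [y e^{-y} + x e^{-x} - x y (e^{-y} + e^{-x})]`. -/
noncomputable def Q (x y : ℝ) : ℝ :=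
  x * y * Real.exp (-x - y) *
    (y * Real.exp (-y) + x * Real.exp (-x) - x * y * (Real.exp (-y) + Real.exp (-x)))

end Excedance

/-!
The number `[b ^ (r - 1) a ^ s]` is obtained by deleting rows of the corresponding board of
permutations.  Passing from the condition `π 0 > k` to "no condition" minus "`π 0 ≤ k`" gives a
two-term recursion (`boardCount_succ`), which is the recursion satisfied by the derivatives at
`x = 0` of the powers of `1 / (1 - e ^ y (1 - e ^ (-x)))`.  Hence `[b ^ (r - 1) a ^ s]` is the
derivative of order `(r, s)` at the origin of
`F(x, y) = 1 / (1 - e ^ y (1 - e ^ (-x))) = e ^ (-y) / (e ^ (-x) + e ^ (-y) - 1)`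
(`iteratedDeriv_xDeriv`).

The poles of `F` lie on the curve `e ^ (-x) + e ^ (-y) = 1`, the graph of the involution
`dual t = -log (1 - e ^ (-t))`.  Since `f (dual t) = 1 / f t` and `f` is strictly decreasing (it is
a quotient of secant slopes of `log`), `x(r, s) = dual (y(r, s))`, and the condition on `s / r`
says that both numbers are at most `1 = f⁻¹(ε₀)`.

For fixed `y` the coefficient of `x ^ r` in `F` is, up to an error of order `2 ^ (-r)`, the
contribution `e ^ (X - y) X ^ (-r - 1)` of the pole `X = X(y)` nearest to the origin, as long as `y`
is near the positive real axis (`exists_norm_xDeriv_sub_le`).  On the rest of the circle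
`|y| = y(r, s)` the coefficient is exponentially smaller, because `F` is a geometric series in
`(e ^ x - 1) (e ^ y - 1)` and `|e ^ y - 1|` is maximal only at the real point (`exists_far_bound`).
Cauchy's formula in `y` therefore yields an integral of `P(θ) A(θ) ^ r`, where `A` is `1` to first
order at `θ = 0` by the choice of `y(r, s)`, and Laplace's method (`exists_laplace_bound`) gives
the leading term with an absolute error `O(1 / r)`.  All constants are uniform because the
ordinate `y(r, s)` ranges over the compact interval `[dual 1, 1]`, on which the curvature is
positive: the bracket in `Q` equals `x e ^ (-x) (1 - y) + y e ^ (-y) (1 - x)`.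
-/

/-! ### The bracket numbers as iterated differences -/

namespace ExcedanceAsymptotics

/-- The number of permutations `π` of `n` points whose rows `i < p` satisfy `π i > k + i` and whose
other rows satisfy `π i ≤ k + i`.  The permutations with excedance word `b ^ p a ^ s` are the case
`k = 0`, `n = p + s + 1`; the offset `k` makes the family closed under deleting a row. -/
noncomputable def boardCount (n p k : ℕ) : ℕ :=
  Nat.card {π : Equiv.Perm (Fin n) //
    ∀ i : Fin n, ((i : ℕ) < p → k + i < π i) ∧ (p ≤ (i : ℕ) → (π i : ℕ) ≤ k + i)}

theorem bracket_baWord (p s : ℕ) :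
    Excedance.bracket (Excedance.baWord p s) = boardCount (p + s + 1) p 0 := by
  refine Nat.card_congr (Equiv.subtypeEquivRight fun π => ?_)
  constructor
  · intro h i
    induction i using Fin.lastCases with
    | last =>
      have := (π (Fin.last (p + s))).is_lt
      simp only [Fin.val_last]
      constructor <;> intro h' <;> omega
    | cast i =>
      have hi := congrFun h i
      simp only [Excedance.excedanceWord, Excedance.baWord, Fin.lt_def] at hi
      simp only [Fin.val_castSucc] at hi ⊢
      constructor
      · intro h'
        rw [if_pos h'] at hi
        by_contra hc
        rw [if_neg (c := (i : ℕ) < _) (by omega)] at hi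
        cases hi
      · intro h'
        rw [if_neg (c := (i : ℕ) < p) (by omega)] at hi
        by_contra hc
        rw [if_pos (by omega)] at hi
        cases hi
  · intro h
    funext i
    have hi := h i.castSucc
    simp only [Fin.val_castSucc] at hi
    simp only [Excedance.excedanceWord, Excedance.baWord, Fin.lt_def, Fin.val_castSucc]
    by_cases h' : (i : ℕ) < p
    · rw [if_pos h', if_pos (by have := hi.1 h'; omega)]
    · rw [if_neg h', if_neg (by have := hi.2 (by omega); omega)]

/-- The permutation of `n + 1` points that sends `0` to `c` and acts on the remaining points,
relabelled increasingly, as `σ`. -/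
def permCons {n : ℕ} (c : Fin (n + 1)) (σ : Equiv.Perm (Fin n)) : Equiv.Perm (Fin (n + 1)) :=
  ((finSuccEquiv' 0).trans (Equiv.optionCongr σ)).trans (finSuccEquiv' c).symm

theorem permCons_zero {n : ℕ} (c : Fin (n + 1)) (σ : Equiv.Perm (Fin n)) :
    permCons c σ 0 = c := by
  simp [permCons]

theorem permCons_succ {n : ℕ} (c : Fin (n + 1)) (σ : Equiv.Perm (Fin n)) (i : Fin n) :
    permCons c σ i.succ = c.succAbove (σ i) := by
  simp [permCons, finSuccEquiv'_zero]

theorem permCons_bijective (n : ℕ) :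
    Function.Bijective fun q : Fin (n + 1) × Equiv.Perm (Fin n) => permCons q.1 q.2 := by
  rw [Fintype.bijective_iff_injective_and_card]
  constructor
  · rintro ⟨c, σ⟩ ⟨d, τ⟩ h
    simp only at h
    have hc : c = d := by
      rw [← permCons_zero c σ, h, permCons_zero]
    subst hc
    have : σ = τ := by
      ext i
      have h1 := permCons_succ c σ i
      rw [h, permCons_succ] at h1
      exact congrArg Fin.val (Fin.succAbove_right_injective h1).symm
    rw [this]
  · simp [Fintype.card_perm, Nat.factorial_succ]

theorem val_succAbove_le_iff {n k j : ℕ} (c : Fin (n + 1)) (hc : (c : ℕ) ≤ k) (hkj : k ≤ j)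
    (a : Fin n) : (c.succAbove a : ℕ) ≤ j + 1 ↔ (a : ℕ) ≤ j := by
  rcases lt_or_ge a.castSucc c with h | h
  · rw [Fin.succAbove_of_castSucc_lt c a h]
    rw [Fin.lt_def, Fin.val_castSucc] at h
    rw [Fin.val_castSucc]
    omega
  · rw [Fin.succAbove_of_le_castSucc c a h, Fin.val_succ]
    omega

/-- Rotating the rows cyclically moves the unrestricted row `0` to the last place, where the
condition on it is vacuous; all other rows move up by one, which raises the offset. -/
theorem card_free_row (n p k : ℕ) (hp : p ≤ n) :
    Nat.card {π : Equiv.Perm (Fin (n + 1)) // ∀ i : Fin n,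
      ((i : ℕ) < p → k + i + 1 < π i.succ) ∧ (p ≤ (i : ℕ) → (π i.succ : ℕ) ≤ k + i + 1)} =
      boardCount (n + 1) p (k + 1) := by
  refine Nat.card_congr (Equiv.subtypeEquiv (Equiv.mulRight (finRotate (n + 1))) fun π => ?_)
  simp only [Equiv.coe_mulRight, Equiv.Perm.mul_apply]
  constructor
  · intro h i
    induction i using Fin.lastCases with
    | last =>
      have := (π (finRotate (n + 1) (Fin.last n))).is_lt
      simp only [Fin.val_last]
      constructor <;> intro h' <;> omega
    | cast i =>
      have hi := h i
      have hr : finRotate (n + 1) i.castSucc = i.succ := by simp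
      rw [hr]
      simp only [Fin.val_castSucc]
      constructor
      · intro h'; have := hi.1 h'; omega
      · intro h'; have := hi.2 h'; omega
  · intro h i
    have hi := h i.castSucc
    have hr : finRotate (n + 1) i.castSucc = i.succ := by simp
    rw [hr] at hi
    simp only [Fin.val_castSucc] at hi
    constructor
    · intro h'; have := hi.1 h'; omega
    · intro h'; have := hi.2 h'; omega

/-- If row `0` takes a column `c ≤ k`, then deleting the row and the column leaves a board of the
same kind and offset, whichever of the `k + 1` columns was taken. -/
theorem card_low_row (n p k : ℕ) (hk : k ≤ n) :
    Nat.card {π : Equiv.Perm (Fin (n + 1)) // (π 0 : ℕ) ≤ k ∧ ∀ i : Fin n,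
      ((i : ℕ) < p → k + i + 1 < π i.succ) ∧ (p ≤ (i : ℕ) → (π i.succ : ℕ) ≤ k + i + 1)} =
      (k + 1) * boardCount n p k := by
  have e1 : Nat.card {q : Fin (n + 1) × Equiv.Perm (Fin n) // (q.1 : ℕ) ≤ k ∧
      ∀ i : Fin n, ((i : ℕ) < p → k + i < q.2 i) ∧ (p ≤ (i : ℕ) → (q.2 i : ℕ) ≤ k + i)} =
      (k + 1) * boardCount n p k := by
    rw [Nat.card_congr (Equiv.subtypeProdEquivProd (p := fun c : Fin (n + 1) => (c : ℕ) ≤ k)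
      (q := fun σ : Equiv.Perm (Fin n) => ∀ i : Fin n, ((i : ℕ) < p → k + i < σ i) ∧
        (p ≤ (i : ℕ) → (σ i : ℕ) ≤ k + i))), Nat.card_prod]
    congr 1
    rw [← Nat.card_fin (k + 1)]
    refine Nat.card_congr ⟨fun c => ⟨c.1, by have := c.2; omega⟩,
      fun c => ⟨⟨c, by omega⟩, by simp only; omega⟩, fun c => by simp, fun c => by simp⟩
  rw [← e1]
  refine (Nat.card_congr (Equiv.subtypeEquiv (Equiv.ofBijective _ (permCons_bijective n))
    fun q => ?_)).symm
  simp only [Equiv.ofBijective_apply, permCons_zero, permCons_succ]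
  refine and_congr_right fun hc => forall_congr' fun i => ?_
  have := val_succAbove_le_iff q.1 hc (Nat.le_add_right k i) (q.2 i)
  constructor
  · rintro ⟨h1, h2⟩
    exact ⟨fun h' => by have := h1 h'; omega, fun h' => by have := h2 h'; omega⟩
  · rintro ⟨h1, h2⟩
    exact ⟨fun h' => by have := h1 h'; omega, fun h' => by have := h2 h'; omega⟩

theorem boardCount_zero_succ (n k : ℕ) (hk : k ≤ n) :
    boardCount (n + 1) 0 k = (k + 1) * boardCount n 0 k := by
  rw [← card_low_row n 0 k hk]
  refine Nat.card_congr (Equiv.subtypeEquivRight fun π => ?_)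
  rw [Fin.forall_fin_succ]
  refine and_congr (by simp) (forall_congr' fun i => ?_)
  simp [Nat.add_assoc]

/-- The permutations whose first row is unrestricted are classified by whether the first row
exceeds `k`. -/
theorem boardCount_succ (n p k : ℕ) (hk : k ≤ n) (hp : p ≤ n) :
    boardCount (n + 1) (p + 1) k + (k + 1) * boardCount n p k = boardCount (n + 1) p (k + 1) := by
  rw [← card_low_row n p k hk, ← card_free_row n p k hp]
  have e : boardCount (n + 1) (p + 1) k =
      Nat.card {π : Equiv.Perm (Fin (n + 1)) // ¬ (π 0 : ℕ) ≤ k ∧ ∀ i : Fin n,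
      ((i : ℕ) < p → k + i + 1 < π i.succ) ∧ (p ≤ (i : ℕ) → (π i.succ : ℕ) ≤ k + i + 1)} := by
    refine Nat.card_congr (Equiv.subtypeEquivRight fun π => ?_)
    rw [Fin.forall_fin_succ]
    refine and_congr (by simp) (forall_congr' fun i => ?_)
    simp [Nat.add_assoc]
  rw [e]
  classical
  simp only [Nat.card_eq_fintype_card, Fintype.card_subtype]
  rw [← Finset.card_filter_add_card_filter_not (s := Finset.univ.filter fun π :
    Equiv.Perm (Fin (n + 1)) => ∀ i : Fin n, ((i : ℕ) < p → k + i + 1 < π i.succ) ∧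
      (p ≤ (i : ℕ) → (π i.succ : ℕ) ≤ k + i + 1)) (fun π => (π 0 : ℕ) ≤ k),
    Finset.filter_filter, Finset.filter_filter, add_comm]
  congr 2 <;> ext π <;> simp [and_comm]

theorem boardCount_full (k : ℕ) : boardCount k 0 k = k.factorial := by
  have e : Nat.card (Equiv.Perm (Fin k)) = k.factorial := by
    rw [Nat.card_eq_fintype_card, Fintype.card_perm, Fintype.card_fin]
  rw [← e]
  refine Nat.card_congr (Equiv.subtypeUnivEquiv fun π i => ?_)
  have := (π i).is_lt
  omega

theorem boardCount_zero (s k : ℕ) : boardCount (k + s) 0 k = (k + 1) ^ s * k.factorial := by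
  induction s with
  | zero => simpa using boardCount_full k
  | succ s ih => rw [← add_assoc, boardCount_zero_succ _ _ (by omega), ih]; ring

/-- The array `v j k` obtained from an initial row by `v (j + 1) k = v j (k + 1) - k * v j k`: on
`k ! * c k` it computes `k !` times the coefficients of `((1 - z) d/dz) ^ j` of `∑ c k z ^ k`. -/
def diffArray {R : Type*} [Ring R] (v : ℕ → R) : ℕ → ℕ → R
  | 0, k => v k
  | j + 1, k => diffArray v j (k + 1) - k * diffArray v j k

theorem boardCount_eq_diffArray (p s k : ℕ) :
    (boardCount (k + p + s + 1) p k : ℂ) =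
      diffArray (fun k : ℕ => (k.factorial : ℂ) * (k : ℂ) ^ s) p (k + 1) := by
  induction p generalizing k with
  | zero =>
    have := boardCount_zero (s + 1) k
    rw [← add_assoc] at this
    simp only [add_zero, this, diffArray, Nat.factorial_succ]
    push_cast
    ring
  | succ p ih =>
    have h := boardCount_succ (k + p + s + 1) p k (by omega) (by omega)
    have h1 := ih (k + 1)
    have h2 := ih k
    rw [show k + 1 + p + s + 1 = k + p + s + 1 + 1 by ring, ← h] at h1
    rw [show k + (p + 1) + s + 1 = k + p + s + 1 + 1 by ring]
    simp only [diffArray]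
    rw [← h1, ← h2]
    push_cast
    ring

theorem bracket_eq_diffArray (r s : ℕ) (hr : 1 ≤ r) :
    (Excedance.bracket (Excedance.baWord (r - 1) s) : ℂ) =
      diffArray (fun k : ℕ => (k.factorial : ℂ) * (k : ℂ) ^ s) r 0 := by
  obtain ⟨p, rfl⟩ : ∃ p, r = p + 1 := ⟨r - 1, by omega⟩
  have := boardCount_eq_diffArray p s 0
  rw [Nat.add_sub_cancel, bracket_baWord, diffArray]
  simpa using this

end ExcedanceAsymptotics

/-! ### The function `f` and the involution `dual` -/

namespace ExcedanceAsymptotics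

section

open Set

/-- The involution `t ↦ -log (1 - e ^ (-t))` of `(0, ∞)`, whose graph is the curve
`e ^ (-x) + e ^ (-y) = 1`. -/
noncomputable def dual (t : ℝ) : ℝ := -Real.log (1 - Real.exp (-t))

theorem one_sub_exp_neg_pos {t : ℝ} (ht : 0 < t) : 0 < 1 - Real.exp (-t) := by
  have : Real.exp (-t) < 1 := Real.exp_lt_one_iff.2 (by linarith)
  linarith

theorem dual_pos {t : ℝ} (ht : 0 < t) : 0 < dual t := by
  have h1 := one_sub_exp_neg_pos ht
  have := Real.log_neg h1 (by have := Real.exp_pos (-t); linarith)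
  rw [dual]; linarith

theorem exp_neg_dual {t : ℝ} (ht : 0 < t) : Real.exp (-dual t) = 1 - Real.exp (-t) := by
  rw [dual, neg_neg, Real.exp_log (one_sub_exp_neg_pos ht)]

theorem dual_dual {t : ℝ} (ht : 0 < t) : dual (dual t) = t := by
  rw [dual, exp_neg_dual ht]; simp

theorem f_eq {t : ℝ} : Excedance.f t = (Real.exp t - 1) * dual t / t := by
  rw [Excedance.f, dual]; ring

theorem f_pos {t : ℝ} (ht : 0 < t) : 0 < Excedance.f t := by
  rw [f_eq]
  have h1 := dual_pos ht
  have h2 : 0 < Real.exp t - 1 := by have := Real.add_one_lt_exp ht.ne'; linarith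
  positivity

theorem exp_sub_one_mul_exp_dual_sub_one {t : ℝ} (ht : 0 < t) :
    (Real.exp t - 1) * (Real.exp (dual t) - 1) = 1 := by
  have h := exp_neg_dual ht
  rw [Real.exp_neg, Real.exp_neg] at h
  have h1 := Real.exp_pos t
  have h2 := Real.exp_pos (dual t)
  field_simp at h
  linarith

theorem f_dual {t : ℝ} (ht : 0 < t) : Excedance.f (dual t) = (Excedance.f t)⁻¹ := by
  rw [f_eq, f_eq, dual_dual ht]
  have h := exp_sub_one_mul_exp_dual_sub_one ht
  have h1 := dual_pos ht
  have h2 : Real.exp t - 1 ≠ 0 := left_ne_zero_of_mul_eq_one h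
  rw [eq_inv_of_mul_eq_one_right h]
  field_simp

/-- The negated slope of the secant of `log` between `u` and `1` decreases with `u`. -/
theorem neg_log_div_strictAntiOn :
    StrictAntiOn (fun u : ℝ => -Real.log u / (1 - u)) (Ioo 0 1) := by
  intro u hu v hv huv
  have := strictConcaveOn_log_Ioi.secant_strict_mono (a := 1) (x := u) (y := v) (by simp) hu.1 hv.1
    hu.2.ne hv.2.ne huv
  simp only [Real.log_one, sub_zero] at this
  have e : ∀ w : ℝ, -Real.log w / (1 - w) = Real.log w / (w - 1) := fun w => by
    rw [← neg_sub w 1, neg_div_neg_eq]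
  simpa only [e] using this

/-- With `u = 1 - e ^ (-t)`, the function `f` is the quotient of the decreasing function of
`neg_log_div_strictAntiOn` at `u` by its value at `1 - u`. -/
theorem f_strictAntiOn : StrictAntiOn Excedance.f (Ioi 0) := by
  have key : ∀ t : ℝ, 0 < t → Excedance.f t =
      (-Real.log (1 - Real.exp (-t)) / (1 - (1 - Real.exp (-t)))) /
        (-Real.log (Real.exp (-t)) / (1 - Real.exp (-t))) := by
    intro t ht
    have h1 := one_sub_exp_neg_pos ht
    rw [f_eq, dual, Real.log_exp, Real.exp_neg] at *
    have := Real.exp_pos t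
    field_simp
    ring
  intro s hs t ht hst
  have hs' := one_sub_exp_neg_pos hs
  have ht' := one_sub_exp_neg_pos ht
  have es := Real.exp_pos (-s)
  have et := Real.exp_pos (-t)
  have est : Real.exp (-t) < Real.exp (-s) := Real.exp_lt_exp.2 (by linarith)
  rw [key s hs, key t ht]
  have h1 := neg_log_div_strictAntiOn (a := 1 - Real.exp (-s)) (b := 1 - Real.exp (-t))
    ⟨hs', by linarith⟩ ⟨ht', by linarith⟩ (by linarith)
  have h2 := neg_log_div_strictAntiOn (a := Real.exp (-t)) (b := Real.exp (-s))
    ⟨et, by linarith⟩ ⟨es, by linarith⟩ est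
  have h3 : 0 < -Real.log (Real.exp (-s)) / (1 - Real.exp (-s)) := by
    rw [Real.log_exp, neg_neg]; exact div_pos hs hs'
  have h4 : 0 < -Real.log (1 - Real.exp (-t)) / (1 - (1 - Real.exp (-t))) := by
    rw [sub_sub_cancel]; exact div_pos (dual_pos ht) et
  exact div_lt_div₀ h1 h2.le (h4.le.trans h1.le) h3

theorem dual_le_f {t : ℝ} (ht : 0 < t) : dual t ≤ Excedance.f t := by
  rw [f_eq, le_div_iff₀ ht, mul_comm]
  have := Real.add_one_le_exp t
  exact mul_le_mul_of_nonneg_right (by linarith) (dual_pos ht).le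

theorem f_continuousOn : ContinuousOn Excedance.f (Ioi 0) := by
  intro t ht
  have h1 := one_sub_exp_neg_pos ht
  have h2 : t ≠ 0 := ne_of_gt ht
  apply ContinuousAt.continuousWithinAt
  unfold Excedance.f
  have : ContinuousAt (fun t : ℝ => Real.log (1 - Real.exp (-t))) t :=
    ContinuousAt.log (by fun_prop) h1.ne'
  exact ((by fun_prop : ContinuousAt (fun t : ℝ => 1 - Real.exp t) t).mul this).div
    continuousAt_id h2

/-- Since `f ≥ dual`, the function is unbounded near `0`; by `f_dual` it also takes arbitrarily
small values. -/
theorem f_bijOn : BijOn Excedance.f (Ioi 0) (Ioi 0) := by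
  refine ⟨fun t ht => f_pos ht, f_strictAntiOn.injOn, ?_⟩
  intro v hv
  have hv : 0 < v := hv
  set M := max v v⁻¹ with hM
  have hM0 : 0 < M := lt_max_of_lt_left hv
  have hd := dual_pos hM0
  have h1 : M ≤ Excedance.f (dual M) := by
    have := dual_le_f hd
    rwa [dual_dual hM0] at this
  have h2 : Excedance.f M ≤ v := by
    have h3 := f_dual hM0
    rw [h3] at h1
    have h4 : v⁻¹ ≤ (Excedance.f M)⁻¹ := (le_max_right _ _).trans h1
    exact (inv_le_inv₀ hv (f_pos hM0)).1 h4
  have hc := isPreconnected_Ioi.intermediate_value (s := Ioi (0 : ℝ)) (a := M) (b := dual M)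
    hM0 hd f_continuousOn
  obtain ⟨t, ht, htv⟩ := hc ⟨h2, (le_max_left _ _).trans h1⟩
  exact ⟨t, ht, htv⟩

theorem f_one : Excedance.f 1 = Excedance.eps0 := by
  rw [f_eq, Excedance.eps0, dual, Real.exp_neg]
  have h : 0 < Real.exp 1 - 1 := by have := Real.add_one_lt_exp (one_ne_zero (α := ℝ)); linarith
  have h' := Real.exp_pos 1
  rw [show 1 - (Real.exp 1)⁻¹ = (Real.exp 1 - 1) / Real.exp 1 by field_simp,
    Real.log_div h.ne' h'.ne', Real.log_exp]
  ring

theorem fInv_mem {v : ℝ} (hv : 0 < v) : 0 < Excedance.fInv v :=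
  Function.invFunOn_mem (f_bijOn.surjOn hv)

theorem f_fInv {v : ℝ} (hv : 0 < v) : Excedance.f (Excedance.fInv v) = v :=
  Function.invFunOn_eq (f_bijOn.surjOn hv)

theorem fInv_inv {v : ℝ} (hv : 0 < v) : Excedance.fInv v⁻¹ = dual (Excedance.fInv v) := by
  have h := fInv_mem hv
  refine f_strictAntiOn.injOn (fInv_mem (inv_pos.2 hv)) (dual_pos h) ?_
  rw [f_fInv (inv_pos.2 hv), f_dual h, f_fInv hv]

theorem fInv_le_one {v : ℝ} (hv : Excedance.eps0 ≤ v) : Excedance.fInv v ≤ 1 := by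
  have h0 : 0 < Excedance.eps0 := f_one ▸ f_pos one_pos
  have hv0 : 0 < v := h0.trans_le hv
  by_contra hc
  have := f_strictAntiOn (a := 1) (b := Excedance.fInv v) (mem_Ioi.2 one_pos) (fInv_mem hv0)
    (not_le.1 hc)
  rw [f_fInv hv0, f_one] at this
  linarith

theorem dual_strictAntiOn : StrictAntiOn dual (Ioi 0) := by
  intro s hs t ht hst
  have h1 : Real.exp (-t) < Real.exp (-s) := Real.exp_lt_exp.2 (by linarith)
  have := Real.log_lt_log (one_sub_exp_neg_pos hs) (by linarith : _ < 1 - Real.exp (-t))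
  simp only [dual]
  linarith

/-- In the sector both `x` and `y` are at most `1`, because `f 1 = ε₀`. -/
theorem sector_spec {r s : ℕ} (h : (r, s) ∈ Excedance.sector Excedance.eps0) :
    Excedance.y r s ∈ Icc (dual 1) 1 ∧ Excedance.x r s = dual (Excedance.y r s) ∧
      Excedance.x r s ≤ 1 ∧ Excedance.f (Excedance.x r s) = (s : ℝ) / r := by
  obtain ⟨hr, hs, h1, h2⟩ := h
  simp only at hr hs h1 h2
  have hr' : (0 : ℝ) < r := by exact_mod_cast hr
  have hs' : (0 : ℝ) < s := by exact_mod_cast hs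
  have hrs : (0 : ℝ) < (r : ℝ) / s := by positivity
  have h0 : 0 < Excedance.eps0 := f_one ▸ f_pos one_pos
  have hx : Excedance.x r s = dual (Excedance.y r s) := by
    rw [Excedance.x, Excedance.y, ← fInv_inv hrs, inv_div]
  have hy0 : 0 < Excedance.y r s := fInv_mem hrs
  have hx0 : 0 < Excedance.x r s := hx ▸ dual_pos hy0
  have hx1 : Excedance.x r s ≤ 1 := fInv_le_one h1
  have hy1 : Excedance.y r s ≤ 1 := by
    refine fInv_le_one ?_
    rw [le_div_iff₀ hs']
    rw [div_le_div_iff₀ hr' h0] at h2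
    linarith
  refine ⟨⟨?_, hy1⟩, hx, hx1, f_fInv (by positivity)⟩
  rw [← dual_dual hy0, ← hx]
  exact dual_strictAntiOn.antitoneOn hx0 (mem_Ioi.2 one_pos) hx1

end

end ExcedanceAsymptotics

/-! ### Taylor coefficients of the generating function -/

namespace ExcedanceAsymptotics

section

open Set Metric Filter Topology

/-- The derivative of order `r` at `x = 0` of `1 / (1 - e ^ y * (1 - e ^ (-x)))`, as an exponential
polynomial in `y`. -/
noncomputable def xDeriv (r : ℕ) (y : ℂ) : ℂ :=
  diffArray (fun k : ℕ => (k.factorial : ℂ) * Complex.exp (k * y)) r 0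

theorem differentiable_diffArray (j k : ℕ) : Differentiable ℂ fun y : ℂ =>
    diffArray (fun k : ℕ => (k.factorial : ℂ) * Complex.exp (k * y)) j k := by
  induction j generalizing k with
  | zero => simp only [diffArray]; fun_prop
  | succ j ih => simp only [diffArray]; exact (ih _).sub ((ih _).const_mul _)

theorem differentiable_xDeriv (r : ℕ) : Differentiable ℂ (xDeriv r) :=
  differentiable_diffArray r 0

theorem iteratedDeriv_diffArray (s j k : ℕ) : iteratedDeriv s (fun y : ℂ =>
    diffArray (fun k : ℕ => (k.factorial : ℂ) * Complex.exp (k * y)) j k) 0 =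
      diffArray (fun k : ℕ => (k.factorial : ℂ) * (k : ℂ) ^ s) j k := by
  induction j generalizing k with
  | zero =>
    simp only [diffArray]
    rw [iteratedDeriv_const_mul_field, iteratedDeriv_cexp_const_mul]
    simp
  | succ j ih =>
    simp only [diffArray]
    have h1 := (differentiable_diffArray j (k + 1)).contDiff (n := s)
    have h2 := ((differentiable_diffArray j k).const_mul (k : ℂ)).contDiff (n := s)
    have := iteratedDeriv_sub (n := s) (x := 0) h1.contDiffAt h2.contDiffAt
    rw [← ih, ← ih, ← iteratedDeriv_const_mul_field, ← this]
    rfl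

theorem iteratedDeriv_xDeriv (r s : ℕ) (hr : 1 ≤ r) :
    iteratedDeriv s (xDeriv r) 0 = Excedance.bracket (Excedance.baWord (r - 1) s) := by
  rw [bracket_eq_diffArray r s hr]
  exact iteratedDeriv_diffArray s r 0

/-- Differentiation in `x` acts on the powers of `1 / (1 - e ^ y (1 - e ^ (-x)))` by the recursion
that defines `diffArray`. -/
theorem hasDerivAt_power (y : ℂ) (k : ℕ) {x : ℂ}
    (hx : 1 - Complex.exp y * (1 - Complex.exp (-x)) ≠ 0) :
    HasDerivAt (fun x => (k.factorial : ℂ) * Complex.exp (k * (y - x)) /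
        (1 - Complex.exp y * (1 - Complex.exp (-x))) ^ (k + 1))
      (((k + 1).factorial : ℂ) * Complex.exp ((k + 1 : ℕ) * (y - x)) /
        (1 - Complex.exp y * (1 - Complex.exp (-x))) ^ (k + 1 + 1) -
        k * ((k.factorial : ℂ) * Complex.exp (k * (y - x)) /
        (1 - Complex.exp y * (1 - Complex.exp (-x))) ^ (k + 1))) x := by
  have h1 : HasDerivAt (fun x : ℂ => (k.factorial : ℂ) * Complex.exp (k * (y - x)))
      (-k * ((k.factorial : ℂ) * Complex.exp (k * (y - x)))) x := by
    have := ((((hasDerivAt_id x).const_sub y).const_mul (k : ℂ)).cexp).const_mul (k.factorial : ℂ)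
    refine this.congr_deriv ?_
    simp only [id]
    ring
  have h2 : HasDerivAt (fun x : ℂ => 1 - Complex.exp y * (1 - Complex.exp (-x)))
      (-(Complex.exp (y - x))) x := by
    have := (((((hasDerivAt_id x).neg).cexp).const_sub 1).const_mul (Complex.exp y)).const_sub 1
    refine this.congr_deriv ?_
    rw [sub_eq_add_neg y x, Complex.exp_add]
    simp
  refine (h1.div (h2.pow (k + 1)) (pow_ne_zero _ hx)).congr_deriv ?_
  have e : Complex.exp ((k + 1 : ℕ) * (y - x)) =
      Complex.exp (k * (y - x)) * Complex.exp (y - x) := by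
    rw [← Complex.exp_add]; congr 1; push_cast; ring
  rw [e, Nat.factorial_succ]
  simp only [Pi.pow_apply]
  field_simp
  push_cast
  ring

theorem diffArray_eq_iteratedDeriv (y : ℂ) (j k : ℕ) :
    diffArray (fun k : ℕ => (k.factorial : ℂ) * Complex.exp (k * y)) j k =
      iteratedDeriv j (fun x => (k.factorial : ℂ) * Complex.exp (k * (y - x)) /
        (1 - Complex.exp y * (1 - Complex.exp (-x))) ^ (k + 1)) 0 := by
  induction j generalizing k with
  | zero => simp [diffArray]
  | succ j ih =>
    have hne : ∀ᶠ x : ℂ in 𝓝 0, 1 - Complex.exp y * (1 - Complex.exp (-x)) ≠ 0 := by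
      have : ContinuousAt (fun x : ℂ => 1 - Complex.exp y * (1 - Complex.exp (-x))) 0 := by
        fun_prop
      exact this.eventually_ne (by simp)
    have hcd : ∀ i : ℕ, ContDiffAt ℂ j (fun x => (i.factorial : ℂ) * Complex.exp (i * (y - x)) /
        (1 - Complex.exp y * (1 - Complex.exp (-x))) ^ (i + 1)) 0 := by
      intro i
      refine ContDiffAt.div (by fun_prop) (by fun_prop) (by simp)
    rw [iteratedDeriv_succ', EventuallyEq.iteratedDeriv_eq j
      (hne.mono fun x hx => (hasDerivAt_power y k hx).deriv)]
    have := iteratedDeriv_sub (hcd (k + 1)) (contDiffAt_const (c := (k : ℂ)).mul (hcd k))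
    refine Eq.trans ?_ this.symm
    rw [diffArray, ih, ih]
    congr 1
    exact (iteratedDeriv_const_mul_field (k : ℂ) _).symm

theorem xDeriv_eq_iteratedDeriv (r : ℕ) (y : ℂ) : xDeriv r y =
    iteratedDeriv r (fun x => 1 / (1 - Complex.exp y * (1 - Complex.exp (-x)))) 0 := by
  rw [xDeriv, diffArray_eq_iteratedDeriv]
  simp

/-- Cauchy's estimate on a disc on which the geometric series in `(e ^ x - 1) (e ^ y - 1)`
converges. -/
theorem norm_xDeriv_le (r : ℕ) {y : ℂ} {R q : ℝ} (hR : 0 < R) (hq : q < 1)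
    (h : (Real.exp R - 1) * ‖Complex.exp y - 1‖ ≤ q) :
    ‖xDeriv r y‖ ≤ r.factorial * (Real.exp R / (1 - q)) / R ^ r := by
  have key : ∀ x ∈ closedBall (0 : ℂ) R,
      1 - q ≤ ‖Complex.exp x * (1 - Complex.exp y * (1 - Complex.exp (-x)))‖ := by
    intro x hx
    have hx : ‖x‖ ≤ R := by simpa using hx
    have e : Complex.exp x * (1 - Complex.exp y * (1 - Complex.exp (-x))) =
        1 - (Complex.exp x - 1) * (Complex.exp y - 1) := by
      have : Complex.exp x * Complex.exp (-x) = 1 := by rw [← Complex.exp_add]; simp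
      linear_combination Complex.exp y * this
    have h1 : ‖Complex.exp x - 1‖ ≤ Real.exp R - 1 := by
      have h2 := Complex.norm_exp_sub_sum_le_exp_norm_sub_sum x 1
      have h3 := Real.exp_le_exp.2 hx
      simp only [Finset.sum_range_one, pow_zero, Nat.factorial_zero, Nat.cast_one, div_one] at h2
      linarith
    have h4 := norm_sub_norm_le (1 : ℂ) ((Complex.exp x - 1) * (Complex.exp y - 1))
    rw [norm_one, norm_mul] at h4
    have h5 := mul_le_mul_of_nonneg_right h1 (norm_nonneg (Complex.exp y - 1))
    rw [e]
    linarith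
  have hne : ∀ x ∈ closedBall (0 : ℂ) R, 1 - Complex.exp y * (1 - Complex.exp (-x)) ≠ 0 := by
    intro x hx h0
    have := key x hx
    rw [h0, mul_zero, norm_zero] at this
    linarith
  rw [xDeriv_eq_iteratedDeriv]
  refine Complex.norm_iteratedDeriv_le_of_forall_mem_sphere_norm_le r hR ?_ ?_
  · refine DifferentiableOn.diffContOnCl_ball (U := closedBall 0 R) ?_ subset_rfl
    exact DifferentiableOn.div (by fun_prop) (by fun_prop) hne
  · intro x hx
    have h1 := key x (sphere_subset_closedBall hx)
    have h2 : 0 < ‖1 - Complex.exp y * (1 - Complex.exp (-x))‖ :=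
      norm_pos_iff.2 (hne x (sphere_subset_closedBall hx))
    rw [norm_mul, Complex.norm_exp] at h1
    have h3 : Real.exp x.re ≤ Real.exp R := by
      refine Real.exp_le_exp.2 ((Complex.re_le_norm x).trans ?_)
      simpa using hx.le
    have h4 := mul_le_mul_of_nonneg_right h3 h2.le
    rw [norm_div, norm_one, div_le_div_iff₀ h2 (by linarith)]
    linarith

/-- The polar part of `1 / (e ^ (-w) - 1)` at `0` is `-1 / w`, and there is no other pole in the
disc of radius `2π`. -/
theorem exists_regular_part : ∃ (g : ℂ → ℂ) (M : ℝ), DifferentiableOn ℂ g (ball 0 (2 * Real.pi)) ∧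
    (∀ w ∈ closedBall (0 : ℂ) 4, ‖g w‖ ≤ M) ∧
    ∀ w ∈ ball (0 : ℂ) (2 * Real.pi), w ≠ 0 → (Complex.exp (-w) - 1)⁻¹ = -w⁻¹ + g w := by
  have hb : ball (0 : ℂ) (2 * Real.pi) ∈ 𝓝 0 := ball_mem_nhds _ (by positivity)
  set h : ℂ → ℂ := fun w => -Complex.exp (-w)
  have hh : HasDerivAt h 1 0 := by
    refine ((hasDerivAt_id (0 : ℂ)).neg.cexp).neg.congr_deriv ?_
    simp
  set u := dslope h 0
  have hu0 : u 0 = 1 := by rw [show u 0 = deriv h 0 from dslope_same _ _, hh.deriv]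
  have hu : ∀ w, w * u w = 1 - Complex.exp (-w) := by
    intro w
    have := sub_smul_dslope h 0 w
    simp only [sub_zero, smul_eq_mul] at this
    rw [this]; simp [h]; ring
  have hud : DifferentiableOn ℂ u (ball 0 (2 * Real.pi)) :=
    (Complex.differentiableOn_dslope hb).2 (by fun_prop)
  have hune : ∀ w ∈ ball (0 : ℂ) (2 * Real.pi), u w ≠ 0 := by
    intro w hw h0
    have h1 := hu w
    rw [h0, mul_zero] at h1
    have h2 : Complex.exp (-w) = 1 := by linear_combination h1
    obtain ⟨n, hn⟩ := Complex.exp_eq_one_iff.1 h2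
    have h3 : ‖w‖ = |(n : ℝ)| * (2 * Real.pi) := by
      rw [← norm_neg, hn]
      simp [abs_of_pos Real.pi_pos]
    have h4 : ‖w‖ < 2 * Real.pi := by simpa using hw
    have h5 : |(n : ℝ)| < 1 := by
      by_contra hc
      have := mul_le_mul_of_nonneg_right (not_lt.1 hc) (Real.two_pi_pos.le)
      linarith
    have h6 : n = 0 := by
      rw [← Int.abs_lt_one_iff]; exact_mod_cast h5
    rw [h6] at hn
    have : w = 0 := by simpa using hn
    rw [this, hu0] at h0
    exact one_ne_zero h0
  have hv : DifferentiableOn ℂ (dslope u 0) (ball 0 (2 * Real.pi)) :=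
    (Complex.differentiableOn_dslope hb).2 hud
  have hg := hv.div hud hune
  have hsub : closedBall (0 : ℂ) 4 ⊆ ball 0 (2 * Real.pi) :=
    closedBall_subset_ball (by have := Real.pi_gt_three; linarith)
  obtain ⟨M, hM⟩ := (isCompact_closedBall (0 : ℂ) 4).exists_bound_of_continuousOn
    (hg.continuousOn.mono hsub)
  refine ⟨_, M, hg, hM, fun w hw hw0 => ?_⟩
  have h1 := sub_smul_dslope u 0 w
  simp only [sub_zero, smul_eq_mul, hu0] at h1
  have h2 := hu w
  have h3 := hune w hw
  have h4 : Complex.exp (-w) - 1 = -(w * u w) := by rw [h2]; ring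
  rw [h4, Pi.div_apply]
  field_simp
  linear_combination -h1

theorem iteratedDeriv_inv_sub_zero (r : ℕ) (X : ℂ) :
    iteratedDeriv r (fun x : ℂ => (X - x)⁻¹) 0 = r.factorial / X ^ (r + 1) := by
  have h := iter_deriv_inv_linear_sub r (-1 : ℂ) (-X)
  have e : (fun x : ℂ => (X - x)⁻¹) = fun x => ((-1) * x - (-X))⁻¹ := by
    funext x; congr 1; ring
  rw [iteratedDeriv_eq_iterate, e, h]
  have h2 : (-1 : ℂ) ^ r * (-1) ^ r = 1 := by rw [← mul_pow]; simp
  have h3 : (-1 * 0 - -X : ℂ) ^ (-1 - r : ℤ) = (X ^ (r + 1))⁻¹ := by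
    rw [show (-1 - r : ℤ) = -((r + 1 : ℕ) : ℤ) by push_cast; ring, zpow_neg, zpow_natCast]
    simp
  simp only [h3]
  rw [div_eq_mul_inv]
  linear_combination (r.factorial : ℂ) * (X ^ (r + 1))⁻¹ * h2

/-- Near the curve `e ^ (-X) + e ^ (-y) = 1`, the Taylor coefficients in `x` are those of the simple
pole at `X`, up to an error of order `2 ^ (-r)`. -/
theorem exists_norm_xDeriv_sub_le : ∃ M : ℝ, ∀ (r : ℕ) (y X : ℂ), X ≠ 0 → ‖X‖ < 2 →
    Complex.exp (-X) = 1 - Complex.exp (-y) →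
    ‖xDeriv r y / r.factorial - Complex.exp (X - y) / X ^ (r + 1)‖ ≤
      ‖Complex.exp (X - y)‖ * M / 2 ^ r := by
  obtain ⟨g, M, hg, hM, hgw⟩ := exists_regular_part
  refine ⟨M, fun r y X hX hX2 hXy => ?_⟩
  have hpi := Real.pi_gt_three
  have hmaps : MapsTo (fun x : ℂ => x - X) (closedBall 0 2) (ball 0 (2 * Real.pi)) := by
    intro x hx
    have hx : ‖x‖ ≤ 2 := by simpa using hx
    have := norm_sub_le x X
    simp only [mem_ball, dist_zero_right]
    linarith
  have hgX : DifferentiableOn ℂ (fun x => g (x - X)) (closedBall 0 2) :=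
    hg.comp (by fun_prop) hmaps
  have e : (fun x => 1 / (1 - Complex.exp y * (1 - Complex.exp (-x)))) =ᶠ[𝓝 0]
      fun x => Complex.exp (X - y) * ((X - x)⁻¹ + g (x - X)) := by
    have h1 : ∀ᶠ x : ℂ in 𝓝 0, x ≠ X := eventually_ne_nhds hX.symm
    filter_upwards [h1, closedBall_mem_nhds (0 : ℂ) two_pos] with x hx hx2
    have h2 := hgw (x - X) (hmaps hx2) (sub_ne_zero.2 hx)
    have h3 : (X - x)⁻¹ + g (x - X) = (Complex.exp (-(x - X)) - 1)⁻¹ := by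
      rw [h2, ← neg_sub x X, inv_neg]
    have h4 : 1 - Complex.exp y * (1 - Complex.exp (-x)) =
        (Complex.exp (X - y))⁻¹ * (Complex.exp (-(x - X)) - 1) := by
      rw [← Complex.exp_neg, mul_sub, ← Complex.exp_add, mul_sub, ← Complex.exp_add]
      have h5 : Complex.exp (-(X - y)) = Complex.exp y - 1 := by
        rw [show -(X - y) = y + -X by ring, Complex.exp_add, hXy, mul_sub, ← Complex.exp_add]
        simp
      rw [mul_one, mul_one, h5, show -(X - y) + -(x - X) = y + -x by ring]
      ring
    rw [h3, h4, one_div, mul_inv, inv_inv]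
  have hc1 : ContDiffAt ℂ r (fun x : ℂ => (X - x)⁻¹) 0 :=
    ContDiffAt.inv (by fun_prop) (by simpa using hX)
  have hc2 : ContDiffAt ℂ r (fun x => g (x - X)) 0 :=
    (hgX.analyticAt (closedBall_mem_nhds (0 : ℂ) two_pos)).contDiffAt
  have h1 : xDeriv r y = Complex.exp (X - y) *
      (r.factorial / X ^ (r + 1) + iteratedDeriv r (fun x => g (x - X)) 0) := by
    rw [xDeriv_eq_iteratedDeriv, e.iteratedDeriv_eq, iteratedDeriv_const_mul_field,
      ← iteratedDeriv_inv_sub_zero r X]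
    congr 1
    exact iteratedDeriv_add hc1 hc2
  have h2 : ‖iteratedDeriv r (fun x => g (x - X)) 0‖ ≤ r.factorial * M / 2 ^ r := by
    refine Complex.norm_iteratedDeriv_le_of_forall_mem_sphere_norm_le r two_pos
      (hgX.diffContOnCl_ball subset_rfl) fun x hx => hM _ ?_
    have hx : ‖x‖ = 2 := by simpa using hx
    have := norm_sub_le x X
    simp only [mem_closedBall, dist_zero_right]
    linarith
  have hf : (0 : ℝ) < r.factorial := by exact_mod_cast r.factorial_pos
  have hf' : (r.factorial : ℂ) ≠ 0 := by exact_mod_cast r.factorial_ne_zero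
  have h3 : xDeriv r y / r.factorial - Complex.exp (X - y) / X ^ (r + 1) =
      Complex.exp (X - y) * (iteratedDeriv r (fun x => g (x - X)) 0 / r.factorial) := by
    rw [h1]; field_simp; ring
  rw [h3, norm_mul, mul_div_assoc, norm_div, Complex.norm_natCast]
  refine mul_le_mul_of_nonneg_left ?_ (norm_nonneg _)
  rw [div_le_iff₀ hf]
  calc _ ≤ _ := h2
    _ = _ := by ring

theorem iteratedDeriv_eq_integral {g : ℂ → ℂ} (hg : Differentiable ℂ g) (s : ℕ) {R : ℝ}
    (hR : 0 < R) : iteratedDeriv s g 0 / s.factorial =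
      (2 * Real.pi : ℂ)⁻¹ * ∫ θ in (-Real.pi)..Real.pi,
        g (R * Complex.exp (θ * Complex.I)) * Complex.exp (-(s * θ * Complex.I)) / R ^ s := by
  have h := DifferentiableOn.circleIntegral_one_div_sub_center_pow_smul hR s
    (hg.differentiableOn (s := closedBall (0 : ℂ) R))
  have hf : (s.factorial : ℂ) ≠ 0 := by exact_mod_cast s.factorial_ne_zero
  have hR' : (R : ℂ) ≠ 0 := by exact_mod_cast hR.ne'
  have hpi : (Real.pi : ℂ) ≠ 0 := by exact_mod_cast Real.pi_ne_zero
  have hI : ∀ θ : ℝ, deriv (circleMap 0 R) θ •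
      ((1 / (circleMap 0 R θ - 0) ^ (s + 1)) • g (circleMap 0 R θ)) = Complex.I *
        (g (R * Complex.exp (θ * Complex.I)) * Complex.exp (-(s * θ * Complex.I)) / R ^ s) := by
    intro θ
    have h1 : Complex.exp (-(s * θ * Complex.I)) = (Complex.exp (θ * Complex.I) ^ s)⁻¹ := by
      rw [← Complex.exp_nat_mul, ← Complex.exp_neg]; congr 1; ring
    have h2 := Complex.exp_ne_zero (θ * Complex.I)
    rw [deriv_circleMap, h1]
    simp only [circleMap, zero_add, sub_zero, smul_eq_mul]
    field_simp
    ring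
  have hper : Function.Periodic (fun θ : ℝ => Complex.I *
      (g (R * Complex.exp (θ * Complex.I)) * Complex.exp (-(s * θ * Complex.I)) / R ^ s))
        (2 * Real.pi) := by
    intro θ
    simp only [← hI, deriv_circleMap, periodic_circleMap 0 R θ]
  rw [circleIntegral] at h
  simp only [hI] at h
  have h2 := hper.intervalIntegral_add_eq 0 (-Real.pi)
  rw [zero_add, show -Real.pi + 2 * Real.pi = Real.pi by ring] at h2
  rw [h2, intervalIntegral.integral_const_mul, smul_eq_mul] at h
  have hII : Complex.I ≠ 0 := Complex.I_ne_zero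
  generalize (∫ θ in (-Real.pi)..Real.pi,
    g (R * Complex.exp (θ * Complex.I)) * Complex.exp (-(s * θ * Complex.I)) / (R : ℂ) ^ s) = J at *
  field_simp at h ⊢
  linear_combination -h

end

end ExcedanceAsymptotics

/-! ### Laplace's method with uniform constants -/

namespace ExcedanceAsymptotics

section

open Set MeasureTheory

theorem norm_pow_sub_pow_le {a b : ℂ} {m : ℝ} (ha : ‖a‖ ≤ m) (hb : ‖b‖ ≤ m) (n : ℕ) :
    ‖a ^ (n + 1) - b ^ (n + 1)‖ ≤ (n + 1) * m ^ n * ‖a - b‖ := by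
  have hm : 0 ≤ m := (norm_nonneg a).trans ha
  induction n with
  | zero => simp
  | succ n ih =>
    have e : a ^ (n + 1 + 1) - b ^ (n + 1 + 1) =
        a * (a ^ (n + 1) - b ^ (n + 1)) + b ^ (n + 1) * (a - b) := by ring
    have h1 : ‖b ^ (n + 1)‖ ≤ m ^ (n + 1) := by
      rw [norm_pow]; exact pow_le_pow_left₀ (norm_nonneg _) hb _
    rw [e]
    calc _ ≤ ‖a‖ * ‖a ^ (n + 1) - b ^ (n + 1)‖ + ‖b ^ (n + 1)‖ * ‖a - b‖ := by
          rw [← norm_mul, ← norm_mul]; exact norm_add_le _ _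
      _ ≤ m * ((n + 1) * m ^ n * ‖a - b‖) + m ^ (n + 1) * ‖a - b‖ := by gcongr
      _ = _ := by push_cast; ring

theorem integrable_abs_mul_exp {b : ℝ} (hb : 0 < b) :
    Integrable fun θ : ℝ => |θ| * Real.exp (-b * θ ^ 2) := by
  have := (integrable_mul_exp_neg_mul_sq hb).norm
  simpa [abs_mul] using this

theorem integral_abs_mul_exp {b : ℝ} (hb : 0 < b) :
    ∫ θ : ℝ, |θ| * Real.exp (-b * θ ^ 2) = 1 / b := by
  have h := integral_comp_abs (f := fun θ : ℝ => θ * Real.exp (-b * θ ^ 2))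
  simp only [sq_abs] at h
  have h2 := integral_rpow_mul_exp_neg_mul_rpow (p := 2) (q := 1) (b := b) (by norm_num)
    (by norm_num) hb
  have h3 : ∫ θ in Ioi (0 : ℝ), θ * Real.exp (-b * θ ^ 2) = 1 / (2 * b) := by
    norm_num [Real.rpow_neg_one] at h2
    simp only [neg_mul]
    rw [h2]
    field_simp
  rw [h, h3]
  field_simp

/-- Pointwise comparison of `P * A ^ r` with its Gaussian approximation.  The cubic error of the
base is multiplied by `r`, and `r * θ ^ 2` is absorbed into half of the Gaussian decay. -/
theorem norm_mul_pow_sub_gaussian_le {K δ τ₀ τ₁ τ θ : ℝ} {a p p₀ : ℂ} {r : ℕ} (hr : 1 ≤ r)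
    (hK : 0 ≤ K) (hδ1 : δ ≤ 1) (hτ₀ : 0 < τ₀) (hKδ : K * δ ≤ τ₀ / 4)
    (hτδ : τ₁ * δ ^ 2 ≤ 2) (hτ : τ₀ ≤ τ) (hτ' : τ ≤ τ₁) (hθ : |θ| ≤ δ) (hp₀ : ‖p₀‖ ≤ K)
    (ha : ‖a - (1 - τ * θ ^ 2 / 2 : ℝ)‖ ≤ K * |θ| ^ 3) (hp : ‖p - p₀‖ ≤ K * |θ|) :
    ‖p * a ^ r - p₀ * (Real.exp (-(r * τ / 2) * θ ^ 2) : ℝ)‖ ≤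
      (K + K * (K + τ₁ ^ 2) * (Real.exp (τ₀ / 4) * (8 / τ₀))) *
        (|θ| * Real.exp (-(r * τ₀ / 8) * θ ^ 2)) := by
  obtain ⟨n, rfl⟩ : ∃ n, r = n + 1 := ⟨r - 1, by omega⟩
  have hθ0 := abs_nonneg θ
  have hδ0 : 0 ≤ δ := hθ0.trans hθ
  have hsq : θ ^ 2 = |θ| ^ 2 := (sq_abs θ).symm
  have hsq1 : θ ^ 2 ≤ δ ^ 2 := by rw [hsq]; gcongr
  have hsq2 : θ ^ 2 ≤ 1 := hsq1.trans (pow_le_one₀ hδ0 hδ1)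
  have hτpos : 0 < τ := hτ₀.trans_le hτ
  have hu0 : 0 ≤ τ * θ ^ 2 / 2 := by positivity
  have hu1 : τ * θ ^ 2 / 2 ≤ 1 := by
    have : τ * θ ^ 2 ≤ τ₁ * δ ^ 2 := by gcongr; linarith
    linarith
  set m := Real.exp (-(τ₀ / 4) * θ ^ 2) with hm
  set b : ℝ := Real.exp (-(τ / 2) * θ ^ 2) with hb
  have hbm : b ≤ m := by
    rw [hb, hm]; refine Real.exp_le_exp.2 ?_
    have := mul_le_mul_of_nonneg_right (by linarith : τ₀ / 4 ≤ τ / 2) (sq_nonneg θ)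
    linarith
  have ham : ‖a‖ ≤ m := by
    have h1 : ‖a‖ ≤ ‖a - (1 - τ * θ ^ 2 / 2 : ℝ)‖ + ‖((1 - τ * θ ^ 2 / 2 : ℝ) : ℂ)‖ := by
      have := norm_add_le (a - (1 - τ * θ ^ 2 / 2 : ℝ)) ((1 - τ * θ ^ 2 / 2 : ℝ) : ℂ)
      rwa [sub_add_cancel] at this
    rw [Complex.norm_real, Real.norm_of_nonneg (by linarith : (0:ℝ) ≤ 1 - τ * θ ^ 2 / 2)] at h1
    have h2 : K * |θ| ^ 3 ≤ τ₀ / 4 * θ ^ 2 := by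
      calc K * |θ| ^ 3 = K * |θ| * |θ| ^ 2 := by ring
        _ ≤ K * δ * |θ| ^ 2 := by gcongr
        _ ≤ τ₀ / 4 * θ ^ 2 := by rw [hsq]; gcongr
    have h3 := Real.add_one_le_exp (-(τ₀ / 4) * θ ^ 2)
    have h4 := mul_le_mul_of_nonneg_right hτ (sq_nonneg θ)
    rw [← hm] at h3
    linarith
  have hbm' : ‖(b : ℂ)‖ ≤ m := by
    rw [Complex.norm_real, Real.norm_of_nonneg (Real.exp_nonneg _)]; exact hbm
  have hab : ‖a - b‖ ≤ (K + τ₁ ^ 2) * |θ| ^ 3 := by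
    have h1 : |b - (1 - τ * θ ^ 2 / 2)| ≤ τ₁ ^ 2 * |θ| ^ 3 := by
      have h2 := Real.abs_exp_sub_one_sub_id_le (x := -(τ * θ ^ 2 / 2))
        (by rwa [abs_neg, abs_of_nonneg hu0])
      have e : b - (1 - τ * θ ^ 2 / 2) =
          Real.exp (-(τ * θ ^ 2 / 2)) - 1 - -(τ * θ ^ 2 / 2) := by
        rw [hb, show -(τ / 2) * θ ^ 2 = -(τ * θ ^ 2 / 2) by ring]; ring
      rw [e]
      refine h2.trans ?_
      have h3 : |θ| ^ 4 ≤ |θ| ^ 3 := pow_le_pow_of_le_one hθ0 (hθ.trans hδ1) (by norm_num)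
      have h4 : τ ^ 2 ≤ τ₁ ^ 2 := by gcongr
      calc (-(τ * θ ^ 2 / 2)) ^ 2 = τ ^ 2 * |θ| ^ 4 / 4 := by rw [hsq]; ring
        _ ≤ τ ^ 2 * |θ| ^ 4 := by
            have : 0 ≤ τ ^ 2 * |θ| ^ 4 := by positivity
            linarith
        _ ≤ τ₁ ^ 2 * |θ| ^ 3 := by gcongr
    have e : a - b = (a - (1 - τ * θ ^ 2 / 2 : ℝ)) - ((b - (1 - τ * θ ^ 2 / 2) : ℝ) : ℂ) := by
      push_cast; ring
    rw [e]
    refine (norm_sub_le _ _).trans ?_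
    rw [Complex.norm_real, Real.norm_eq_abs]
    linarith
  have hpow : (Real.exp (-((n + 1 : ℕ) * τ / 2) * θ ^ 2) : ℝ) = b ^ (n + 1) := by
    rw [hb, ← Real.exp_nat_mul]; congr 1; push_cast; ring
  have hN : (0 : ℝ) ≤ (n + 1 : ℕ) := by positivity
  set w := Real.exp (-((n + 1 : ℕ) * τ₀ / 8) * θ ^ 2) with hw
  have hmw : m ^ (n + 1) ≤ w := by
    rw [hm, hw, ← Real.exp_nat_mul]
    refine Real.exp_le_exp.2 ?_
    have : 0 ≤ ((n + 1 : ℕ) : ℝ) * τ₀ * θ ^ 2 := by positivity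
    linarith
  -- `u ≤ e ^ u` with `u = r * τ₀ * θ ^ 2 / 8`
  have hmn : (n + 1 : ℝ) * θ ^ 2 * m ^ n ≤ Real.exp (τ₀ / 4) * (8 / τ₀) * w := by
    have h1 : m ^ n ≤ Real.exp (τ₀ / 4) * (w * w) := by
      rw [hm, hw, ← Real.exp_nat_mul, ← Real.exp_add, ← Real.exp_add]
      refine Real.exp_le_exp.2 ?_
      have := mul_le_mul_of_nonneg_left hsq2 hτ₀.le
      push_cast
      linarith
    have h2 : (n + 1 : ℝ) * θ ^ 2 * w ≤ 8 / τ₀ := by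
      have h3 := Real.add_one_le_exp ((n + 1 : ℝ) * τ₀ / 8 * θ ^ 2)
      have h4 : Real.exp ((n + 1 : ℝ) * τ₀ / 8 * θ ^ 2) * w = 1 := by
        rw [hw, ← Real.exp_add, Real.exp_eq_one_iff]; push_cast; ring
      have hw0 : 0 < w := Real.exp_pos _
      rw [le_div_iff₀ hτ₀]
      have h5 := mul_le_mul_of_nonneg_right h3 hw0.le
      rw [h4] at h5
      linarith
    calc (n + 1 : ℝ) * θ ^ 2 * m ^ n
        ≤ (n + 1 : ℝ) * θ ^ 2 * (Real.exp (τ₀ / 4) * (w * w)) := by gcongr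
      _ = Real.exp (τ₀ / 4) * ((n + 1 : ℝ) * θ ^ 2 * w) * w := by ring
      _ ≤ _ := by gcongr
  rw [hpow]
  have e : p * a ^ (n + 1) - p₀ * ((b ^ (n + 1) : ℝ) : ℂ) =
      (p - p₀) * a ^ (n + 1) + p₀ * (a ^ (n + 1) - (b : ℂ) ^ (n + 1)) := by push_cast; ring
  rw [e]
  calc _ ≤ ‖p - p₀‖ * ‖a‖ ^ (n + 1) + ‖p₀‖ * ‖a ^ (n + 1) - (b : ℂ) ^ (n + 1)‖ := by
        rw [← norm_pow, ← norm_mul, ← norm_mul]; exact norm_add_le _ _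
    _ ≤ K * |θ| * m ^ (n + 1) + K * ((n + 1) * m ^ n * ((K + τ₁ ^ 2) * |θ| ^ 3)) := by
        have := norm_pow_sub_pow_le ham hbm' n
        gcongr
        exact this.trans (by gcongr)
    _ = K * |θ| * m ^ (n + 1) + K * (K + τ₁ ^ 2) * |θ| * ((n + 1) * θ ^ 2 * m ^ n) := by
        rw [hsq]; ring
    _ ≤ K * |θ| * w + K * (K + τ₁ ^ 2) * |θ| * (Real.exp (τ₀ / 4) * (8 / τ₀) * w) := by gcongr
    _ = _ := by ring

/-- Laplace's method with a uniform relative error: the constant depends only on the bounds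
`δ, K, τ₀, τ₁`. -/
theorem exists_laplace_bound {δ K τ₀ τ₁ : ℝ} (hδ : 0 < δ) (hδ1 : δ ≤ 1) (hK : 0 ≤ K)
    (hτ₀ : 0 < τ₀) (hKδ : K * δ ≤ τ₀ / 4) (hτδ : τ₁ * δ ^ 2 ≤ 2) :
    ∃ C : ℝ, 0 ≤ C ∧ ∀ (Φ A P : ℝ → ℂ) (P₀ : ℂ) (τ E : ℝ) (r : ℕ), 1 ≤ r → Continuous Φ →
      τ₀ ≤ τ → τ ≤ τ₁ → 0 ≤ E → ‖P₀‖ ≤ K →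
      (∀ θ : ℝ, |θ| ≤ δ → ‖A θ - (1 - τ * θ ^ 2 / 2 : ℝ)‖ ≤ K * |θ| ^ 3) →
      (∀ θ : ℝ, |θ| ≤ δ → ‖P θ - P₀‖ ≤ K * |θ|) →
      (∀ θ : ℝ, |θ| ≤ δ → ‖Φ θ - P θ * A θ ^ r‖ ≤ E) →
      (∀ θ : ℝ, δ ≤ |θ| → |θ| ≤ Real.pi → ‖Φ θ‖ ≤ E) →
      ‖(∫ θ in (-Real.pi)..Real.pi, Φ θ) - P₀ * (Real.sqrt (2 * Real.pi / (r * τ)) : ℝ)‖ ≤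
        C / r + 2 * Real.pi * E := by
  set C₁ := K + K * (K + τ₁ ^ 2) * (Real.exp (τ₀ / 4) * (8 / τ₀)) with hC₁
  have hC₁0 : 0 ≤ C₁ := by positivity
  refine ⟨(C₁ + K / δ) * (8 / τ₀), by positivity, ?_⟩
  intro Φ A P P₀ τ E r hr hΦ hτ hτ' hE hP₀ hA hP hnear hfar
  have hr0 : (0 : ℝ) < r := by exact_mod_cast hr
  have hτpos : 0 < τ := hτ₀.trans_le hτ
  set S : Set ℝ := Icc (-Real.pi) Real.pi with hS
  have hpi := Real.pi_pos
  have hpi3 := Real.pi_gt_three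
  have hb : 0 < r * τ / 2 := by positivity
  have hb₀ : 0 < r * τ₀ / 8 := by positivity
  have hG : Integrable fun θ : ℝ => P₀ * (Real.exp (-(r * τ / 2) * θ ^ 2) : ℝ) :=
    ((integrable_exp_neg_mul_sq hb).ofReal).const_mul P₀
  have hGint : ∫ θ : ℝ, P₀ * (Real.exp (-(r * τ / 2) * θ ^ 2) : ℝ) =
      P₀ * (Real.sqrt (2 * Real.pi / (r * τ)) : ℝ) := by
    rw [integral_const_mul]
    congr 1
    have h1 := integral_ofReal (𝕜 := ℂ) (μ := volume)
      (f := fun θ : ℝ => Real.exp (-(r * τ / 2) * θ ^ 2))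
    rw [integral_gaussian] at h1
    refine h1.trans ?_
    rw [show Real.pi / (r * τ / 2) = 2 * Real.pi / (r * τ) by field_simp]
    rfl
  have hΦS : Integrable (S.indicator Φ) :=
    (integrable_indicator_iff measurableSet_Icc).2 (hΦ.continuousOn.integrableOn_Icc)
  have hΦint : ∫ θ in (-Real.pi)..Real.pi, Φ θ = ∫ θ, S.indicator Φ θ := by
    rw [intervalIntegral.integral_of_le (by linarith), integral_indicator measurableSet_Icc,
      integral_Icc_eq_integral_Ioc]
  have hmajor : Integrable fun θ : ℝ =>
      (C₁ + K / δ) * (|θ| * Real.exp (-(r * τ₀ / 8) * θ ^ 2)) + S.indicator (fun _ => E) θ :=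
    ((integrable_abs_mul_exp hb₀).const_mul _).add
      ((integrable_indicator_iff measurableSet_Icc).2 continuousOn_const.integrableOn_Icc)
  rw [hΦint, ← hGint, ← integral_sub hΦS hG]
  refine (norm_integral_le_of_norm_le hmajor (Filter.Eventually.of_forall fun θ => ?_)).trans ?_
  · set w := |θ| * Real.exp (-(r * τ₀ / 8) * θ ^ 2) with hw
    have hw0 : 0 ≤ w := by positivity
    have hKδ0 : 0 ≤ K / δ := by positivity
    rcases le_or_gt |θ| δ with hθ | hθ
    · have hmem : θ ∈ S := abs_le.1 (hθ.trans (by linarith))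
      rw [indicator_of_mem hmem, indicator_of_mem hmem]
      have h1 := norm_mul_pow_sub_gaussian_le hr hK hδ1 hτ₀ hKδ hτδ hτ hτ' hθ hP₀ (hA θ hθ) (hP θ hθ)
      have h2 := hnear θ hθ
      have h3 := norm_add_le (Φ θ - P θ * A θ ^ r)
        (P θ * A θ ^ r - P₀ * (Real.exp (-(r * τ / 2) * θ ^ 2) : ℝ))
      rw [sub_add_sub_cancel] at h3
      have h4 := mul_nonneg hKδ0 hw0
      rw [← hw, ← hC₁] at h1
      linarith
    · have h1 : ‖P₀ * (Real.exp (-(r * τ / 2) * θ ^ 2) : ℝ)‖ ≤ K / δ * w := by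
        rw [norm_mul, Complex.norm_real, Real.norm_of_nonneg (Real.exp_nonneg _)]
        have h2 : 1 ≤ |θ| / δ := (one_le_div hδ).2 hθ.le
        have h3 : Real.exp (-(r * τ / 2) * θ ^ 2) ≤ Real.exp (-(r * τ₀ / 8) * θ ^ 2) := by
          refine Real.exp_le_exp.2 ?_
          have h4 : r * τ₀ ≤ r * τ := by gcongr
          have h5 : r * τ₀ / 8 ≤ r * τ / 2 := by linarith [mul_pos hr0 hτpos]
          have := mul_le_mul_of_nonneg_right h5 (sq_nonneg θ)
          linarith
        have h6 : K ≤ K * (|θ| / δ) := le_mul_of_one_le_right hK h2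
        calc ‖P₀‖ * Real.exp (-(r * τ / 2) * θ ^ 2)
            ≤ K * (|θ| / δ) * Real.exp (-(r * τ₀ / 8) * θ ^ 2) := by
              gcongr
              exact hP₀.trans h6
          _ = K / δ * w := by rw [hw]; ring
      have h7 : ‖S.indicator Φ θ‖ ≤ S.indicator (fun _ => E) θ := by
        by_cases hmem : θ ∈ S
        · rw [indicator_of_mem hmem, indicator_of_mem hmem]
          exact hfar θ hθ.le (abs_le.2 hmem)
        · rw [indicator_of_notMem hmem, indicator_of_notMem hmem, norm_zero]
      refine (norm_sub_le _ _).trans ?_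
      have h8 := mul_nonneg hC₁0 hw0
      linarith
  · rw [integral_add ((integrable_abs_mul_exp hb₀).const_mul _)
      ((integrable_indicator_iff measurableSet_Icc).2 continuousOn_const.integrableOn_Icc),
      integral_const_mul, integral_abs_mul_exp hb₀, integral_indicator measurableSet_Icc,
      setIntegral_const, smul_eq_mul, Real.volume_real_Icc_of_le (by linarith)]
    refine le_of_eq ?_
    field_simp
    ring

end

end ExcedanceAsymptotics

/-! ### Expansion of the integrand at the saddle point -/

namespace ExcedanceAsymptotics

section

open Set Metric Filter Topology

/-- The holomorphic extension of `dual` to the right half-plane. -/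
noncomputable def cdual (y : ℂ) : ℂ := -Complex.log (1 - Complex.exp (-y))

theorem one_sub_exp_neg_mem_slitPlane {y : ℂ} (hy : 0 < y.re) :
    1 - Complex.exp (-y) ∈ Complex.slitPlane := by
  left
  have h1 := Complex.re_le_norm (Complex.exp (-y))
  rw [Complex.norm_exp, Complex.neg_re] at h1
  have h2 : Real.exp (-y.re) < 1 := Real.exp_lt_one_iff.2 (by linarith)
  rw [Complex.sub_re, Complex.one_re]
  linarith

theorem one_sub_exp_neg_ne_zero {y : ℂ} (hy : 0 < y.re) : 1 - Complex.exp (-y) ≠ 0 :=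
  Complex.slitPlane_ne_zero (one_sub_exp_neg_mem_slitPlane hy)

theorem exp_neg_cdual {y : ℂ} (hy : 0 < y.re) :
    Complex.exp (-cdual y) = 1 - Complex.exp (-y) := by
  rw [cdual, neg_neg, Complex.exp_log (one_sub_exp_neg_ne_zero hy)]

theorem cdual_ne_zero {y : ℂ} (hy : 0 < y.re) : cdual y ≠ 0 := by
  intro h
  have := exp_neg_cdual hy
  rw [h, neg_zero, Complex.exp_zero] at this
  exact Complex.exp_ne_zero (-y) (by linear_combination this)

theorem cdual_ofReal {t : ℝ} (ht : 0 < t) : cdual t = dual t := by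
  rw [cdual, dual, Complex.ofReal_neg, Complex.ofReal_log (one_sub_exp_neg_pos ht).le]
  push_cast
  rfl

theorem hasDerivAt_cdual {y : ℂ} (hy : 0 < y.re) :
    HasDerivAt cdual (-(Complex.exp (-y) / (1 - Complex.exp (-y)))) y := by
  have h1 : HasDerivAt (fun y : ℂ => 1 - Complex.exp (-y)) (Complex.exp (-y)) y := by
    refine ((hasDerivAt_id y).neg.cexp.const_sub 1).congr_deriv ?_
    simp
  exact (h1.clog (one_sub_exp_neg_mem_slitPlane hy)).neg

/-- The logarithmic derivative `-y * X'(y) / X(y)` of `X = cdual`; on the real axis it is the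
direction `s / r` that belongs to the point of the curve with ordinate `y`. -/
noncomputable def cslope (y : ℂ) : ℂ :=
  y * Complex.exp (-y) / ((1 - Complex.exp (-y)) * cdual y)

/-- The real function underlying `cslope`. -/
noncomputable def slope (t : ℝ) : ℝ := t * Real.exp (-t) / ((1 - Real.exp (-t)) * dual t)

theorem cslope_ofReal {t : ℝ} (ht : 0 < t) : cslope t = slope t := by
  rw [cslope, slope, cdual_ofReal ht]
  push_cast
  rfl

theorem f_dual_eq_slope {t : ℝ} (ht : 0 < t) : Excedance.f (dual t) = slope t := by
  rw [f_dual ht, f_eq, slope, Real.exp_neg]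
  have h1 := dual_pos ht
  have h2 : Real.exp t - 1 ≠ 0 := by
    have := Real.add_one_lt_exp ht.ne'; exact ne_of_gt (by linarith)
  have h3 := Real.exp_pos t
  field_simp

/-- The bracket in `Q` for the point of the curve with ordinate `t`. -/
noncomputable def hessian (t : ℝ) : ℝ :=
  dual t * Real.exp (-dual t) * (1 - t) + t * Real.exp (-t) * (1 - dual t)

/-- The second derivative at `θ = 0` of the phase `log X(t * e ^ (i * θ))`, where `X = cdual`. -/
noncomputable def curvature (t : ℝ) : ℝ :=
  t * Real.exp (-t) * hessian t / (dual t * Real.exp (-dual t)) ^ 2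

theorem hasDerivAt_cslope {t : ℝ} (ht : 0 < t) :
    HasDerivAt cslope (curvature t / t) (t : ℂ) := by
  have hre : 0 < (t : ℂ).re := by simpa using ht
  have h1 : HasDerivAt (fun y : ℂ => y * Complex.exp (-y))
      ((1 - t) * Complex.exp (-t)) (t : ℂ) := by
    refine ((hasDerivAt_id (t : ℂ)).mul (hasDerivAt_id (t : ℂ)).neg.cexp).congr_deriv ?_
    simp only [id, Pi.neg_apply]; ring
  have h2 : HasDerivAt (fun y : ℂ => 1 - Complex.exp (-y)) (Complex.exp (-t)) (t : ℂ) := by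
    refine ((hasDerivAt_id (t : ℂ)).neg.cexp.const_sub 1).congr_deriv ?_
    simp
  have hn1 := one_sub_exp_neg_ne_zero hre
  have hn2 := cdual_ne_zero hre
  refine (h1.div (h2.mul (hasDerivAt_cdual hre)) (mul_ne_zero hn1 hn2)).congr_deriv ?_
  have ht0 : (t : ℂ) ≠ 0 := by exact_mod_cast ht.ne'
  rw [curvature, hessian, exp_neg_dual ht]
  simp only [Pi.mul_apply]
  rw [cdual_ofReal ht] at *
  push_cast
  field_simp
  ring

theorem exp_I_re_pos {ζ : ℂ} (hζ : ‖ζ‖ ≤ 1 / 2) : 0 < (Complex.exp (ζ * Complex.I)).re := by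
  have h1 : ‖ζ * Complex.I‖ ≤ 1 / 2 := by simpa using hζ
  have h2 := Complex.norm_exp_sub_sum_le_exp_norm_sub_sum (ζ * Complex.I) 1
  simp only [Finset.sum_range_one, pow_zero, Nat.factorial_zero, Nat.cast_one, div_one] at h2
  have h3 : Real.exp ‖ζ * Complex.I‖ < 2 := by
    have h4 : Real.exp ‖ζ * Complex.I‖ ≤ Real.exp (1 / 2) := Real.exp_le_exp.2 h1
    have h5 : Real.exp (1 / 2) * Real.exp (1 / 2) = Real.exp 1 := by
      rw [← Real.exp_add]; norm_num
    have h6 := Real.exp_one_lt_three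
    nlinarith [Real.exp_pos (1 / 2)]
  have h7 := (abs_le.1 (Complex.abs_re_le_norm (Complex.exp (ζ * Complex.I) - 1))).1
  rw [Complex.sub_re, Complex.one_re] at h7
  linarith

theorem mul_exp_I_re_pos {t : ℝ} (ht : 0 < t) {ζ : ℂ} (hζ : ‖ζ‖ ≤ 1 / 2) :
    0 < ((t : ℂ) * Complex.exp (ζ * Complex.I)).re := by
  rw [Complex.re_ofReal_mul]
  exact mul_pos ht (exp_I_re_pos hζ)

/-- The factor of the integrand that is raised to the power `r`, normalised to be `1` at `0`. -/
noncomputable def base (t : ℝ) (ζ : ℂ) : ℂ :=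
  dual t * Complex.exp (-(slope t * ζ * Complex.I)) / cdual (t * Complex.exp (ζ * Complex.I))

/-- The derivative of `base t`. -/
noncomputable def baseDeriv (t : ℝ) (ζ : ℂ) : ℂ :=
  Complex.I * base t ζ * (cslope (t * Complex.exp (ζ * Complex.I)) - slope t)

/-- The factor of the integrand that does not depend on `r`. -/
noncomputable def amplitude (t : ℝ) (ζ : ℂ) : ℂ :=
  Complex.exp (cdual (t * Complex.exp (ζ * Complex.I)) - t * Complex.exp (ζ * Complex.I)) /
    cdual (t * Complex.exp (ζ * Complex.I))

theorem hasDerivAt_mul_exp_I (t : ℝ) (ζ : ℂ) :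
    HasDerivAt (fun ζ : ℂ => (t : ℂ) * Complex.exp (ζ * Complex.I))
      (t * Complex.exp (ζ * Complex.I) * Complex.I) ζ := by
  refine ((((hasDerivAt_id ζ).mul_const Complex.I).cexp).const_mul (t : ℂ)).congr_deriv ?_
  simp only [id]; ring

theorem hasDerivAt_base {t : ℝ} (ht : 0 < t) {ζ : ℂ} (hζ : ‖ζ‖ ≤ 1 / 2) :
    HasDerivAt (base t) (baseDeriv t ζ) ζ := by
  have hre := mul_exp_I_re_pos ht hζ
  have h1 : HasDerivAt (fun ζ : ℂ => (dual t : ℂ) * Complex.exp (-(slope t * ζ * Complex.I)))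
      (dual t * Complex.exp (-(slope t * ζ * Complex.I)) * (-(slope t * Complex.I))) ζ := by
    refine ((((((hasDerivAt_id ζ).const_mul (slope t : ℂ)).mul_const Complex.I).neg).cexp).const_mul
      (dual t : ℂ)).congr_deriv ?_
    simp only [id, Pi.neg_apply]; ring
  have h2 := (hasDerivAt_cdual hre).comp ζ (hasDerivAt_mul_exp_I t ζ)
  have hn1 := one_sub_exp_neg_ne_zero hre
  have hn2 := cdual_ne_zero hre
  refine (h1.div h2 hn2).congr_deriv ?_
  simp only [Function.comp_apply]
  rw [baseDeriv, base, cslope]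
  field_simp
  ring

theorem base_zero {t : ℝ} (ht : 0 < t) : base t 0 = 1 := by
  have h : (dual t : ℂ) ≠ 0 := by exact_mod_cast (dual_pos ht).ne'
  simp [base, cdual_ofReal ht, h]

theorem baseDeriv_zero {t : ℝ} (ht : 0 < t) : baseDeriv t 0 = 0 := by
  simp [baseDeriv, cslope_ofReal ht]

theorem hasDerivAt_baseDeriv_zero {t : ℝ} (ht : 0 < t) :
    HasDerivAt (baseDeriv t) (-curvature t) 0 := by
  have h1 := hasDerivAt_base ht (ζ := 0) (by simp)
  have h2 : HasDerivAt (fun ζ : ℂ => cslope (t * Complex.exp (ζ * Complex.I)) - slope t)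
      (curvature t / t * (t * Complex.I)) 0 := by
    have h3 : HasDerivAt (fun ζ : ℂ => (t : ℂ) * Complex.exp (ζ * Complex.I)) (t * Complex.I) 0 := by
      simpa using hasDerivAt_mul_exp_I t 0
    have h4 : HasDerivAt cslope (curvature t / t) ((t : ℂ) * Complex.exp (0 * Complex.I)) := by
      simpa using hasDerivAt_cslope ht
    exact (h4.comp (0 : ℂ) h3).sub_const _
  refine ((h1.const_mul Complex.I).mul h2).congr_deriv ?_
  have ht0 : (t : ℂ) ≠ 0 := by exact_mod_cast ht.ne'
  rw [base_zero ht, baseDeriv_zero ht]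
  field_simp
  linear_combination (curvature t : ℂ) * Complex.I_sq

theorem differentiableAt_cslope {y : ℂ} (hy : 0 < y.re) : DifferentiableAt ℂ cslope y := by
  have h2 := (hasDerivAt_cdual hy).differentiableAt
  exact DifferentiableAt.div (by fun_prop) (by fun_prop)
    (mul_ne_zero (one_sub_exp_neg_ne_zero hy) (cdual_ne_zero hy))

theorem differentiableAt_baseDeriv {t : ℝ} (ht : 0 < t) {ζ : ℂ} (hζ : ‖ζ‖ ≤ 1 / 2) :
    DifferentiableAt ℂ (baseDeriv t) ζ := by
  have h1 := (hasDerivAt_base ht hζ).differentiableAt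
  have h2 := (differentiableAt_cslope (mul_exp_I_re_pos ht hζ)).comp ζ
    (hasDerivAt_mul_exp_I t ζ).differentiableAt
  exact (h1.const_mul Complex.I).mul (h2.sub_const _)

theorem differentiableAt_amplitude {t : ℝ} (ht : 0 < t) {ζ : ℂ} (hζ : ‖ζ‖ ≤ 1 / 2) :
    DifferentiableAt ℂ (amplitude t) ζ := by
  have hre := mul_exp_I_re_pos ht hζ
  have h1 := (hasDerivAt_mul_exp_I t ζ).differentiableAt
  have h2 := (hasDerivAt_cdual hre).differentiableAt.comp ζ h1
  exact ((h2.sub h1).cexp).div h2 (cdual_ne_zero hre)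

theorem dual_continuousOn : ContinuousOn dual (Ioi 0) := by
  intro t ht
  have h1 := one_sub_exp_neg_pos ht
  have h2 : ContinuousAt (fun t : ℝ => 1 - Real.exp (-t)) t := by fun_prop
  exact (h2.log h1.ne').neg.continuousWithinAt

theorem slope_continuousOn : ContinuousOn slope (Ioi 0) :=
  ContinuousOn.div (by fun_prop) ((by fun_prop : ContinuousOn _ _).mul dual_continuousOn)
    fun _ ht => (mul_pos (one_sub_exp_neg_pos ht) (dual_pos ht)).ne'

theorem curvature_continuousOn : ContinuousOn curvature (Ioi 0) := by
  have h := dual_continuousOn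
  unfold curvature hessian
  refine ContinuousOn.div (by fun_prop) (by fun_prop) fun t ht => ?_
  have := dual_pos ht
  positivity

/-- The range of the ordinates `y(r, s)` and the disc on which the integrand is expanded. -/
def domain : Set (ℝ × ℂ) := Icc (dual 1) 1 ×ˢ closedBall 0 (1 / 2)

theorem domain_pos {q : ℝ × ℂ} (hq : q ∈ domain) : 0 < q.1 :=
  (dual_pos one_pos).trans_le hq.1.1

theorem isCompact_domain : IsCompact domain := isCompact_Icc.prod (isCompact_closedBall _ _)

theorem domain_re_pos {q : ℝ × ℂ} (hq : q ∈ domain) :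
    0 < ((q.1 : ℂ) * Complex.exp (q.2 * Complex.I)).re :=
  mul_exp_I_re_pos (domain_pos hq) (by simpa using hq.2)

theorem continuousOn_cdual_domain : ContinuousOn
    (fun q : ℝ × ℂ => cdual ((q.1 : ℂ) * Complex.exp (q.2 * Complex.I))) domain := fun q hq =>
  (ContinuousAt.comp (f := fun q : ℝ × ℂ => (q.1 : ℂ) * Complex.exp (q.2 * Complex.I))
    (hasDerivAt_cdual (domain_re_pos hq)).continuousAt (by fun_prop)).continuousWithinAt

theorem continuousOn_cslope_domain : ContinuousOn
    (fun q : ℝ × ℂ => cslope ((q.1 : ℂ) * Complex.exp (q.2 * Complex.I))) domain := fun q hq =>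
  (ContinuousAt.comp (f := fun q : ℝ × ℂ => (q.1 : ℂ) * Complex.exp (q.2 * Complex.I))
    (differentiableAt_cslope (domain_re_pos hq)).continuousAt (by fun_prop)).continuousWithinAt

theorem mapsTo_fst_domain : MapsTo Prod.fst domain (Ioi (0 : ℝ)) := fun _ hq => domain_pos hq

theorem continuousOn_slope_domain :
    ContinuousOn (fun q : ℝ × ℂ => (slope q.1 : ℂ)) domain :=
  Complex.continuous_ofReal.comp_continuousOn
    (slope_continuousOn.comp continuousOn_fst mapsTo_fst_domain)

theorem continuousOn_base : ContinuousOn (fun q : ℝ × ℂ => base q.1 q.2) domain := by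
  have h1 : ContinuousOn (fun q : ℝ × ℂ => (dual q.1 : ℂ)) domain :=
    Complex.continuous_ofReal.comp_continuousOn
      (dual_continuousOn.comp continuousOn_fst mapsTo_fst_domain)
  have h2 := continuousOn_slope_domain
  exact ContinuousOn.div (by fun_prop) continuousOn_cdual_domain
    fun q hq => cdual_ne_zero (domain_re_pos hq)

theorem continuousOn_baseDeriv : ContinuousOn (fun q : ℝ × ℂ => baseDeriv q.1 q.2) domain :=
  (continuousOn_const.mul continuousOn_base).mul
    (continuousOn_cslope_domain.sub continuousOn_slope_domain)

theorem continuousOn_amplitude : ContinuousOn (fun q : ℝ × ℂ => amplitude q.1 q.2) domain :=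
  ContinuousOn.div (continuousOn_cdual_domain.sub (by fun_prop)).cexp continuousOn_cdual_domain
    fun q hq => cdual_ne_zero (domain_re_pos hq)

theorem norm_dslope_le_of_bounded {g : ℂ → ℂ} {R M : ℝ} (hg : DifferentiableOn ℂ g (ball 0 R))
    (hM : ∀ z ∈ ball (0 : ℂ) R, ‖g z‖ ≤ M) {z : ℂ} (hz : z ∈ ball (0 : ℂ) R) :
    ‖dslope g 0 z‖ ≤ 2 * M / R := by
  refine Complex.norm_dslope_le_div_of_mapsTo_ball hg (fun w hw => ?_) hz
  have hR : 0 < R := (dist_nonneg).trans_lt hz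
  rw [mem_closedBall, dist_eq_norm]
  refine (norm_sub_le _ _).trans ?_
  have h1 := hM w hw
  have h2 := hM 0 (mem_ball_self hR)
  linarith

theorem norm_sub_sub_deriv_le_of_bounded {g : ℂ → ℂ} {R M : ℝ}
    (hg : DifferentiableOn ℂ g (ball 0 R))
    (hM : ∀ z ∈ ball (0 : ℂ) R, ‖g z‖ ≤ M) {z : ℂ} (hz : z ∈ ball (0 : ℂ) R) :
    ‖g z - g 0 - deriv g 0 * z‖ ≤ 2 * (2 * M / R) / R * ‖z‖ ^ 2 := by
  have hR : 0 < R := (dist_nonneg).trans_lt hz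
  have h1 : DifferentiableOn ℂ (dslope g 0) (ball 0 R) :=
    (Complex.differentiableOn_dslope (ball_mem_nhds _ hR)).2 hg
  have h2 := norm_dslope_le_of_bounded h1 (fun w hw => norm_dslope_le_of_bounded hg hM hw) hz
  have h3 := sub_smul_dslope g 0 z
  have h4 := sub_smul_dslope (dslope g 0) 0 z
  rw [dslope_same] at h4
  simp only [sub_zero, smul_eq_mul] at h3 h4
  have e : g z - g 0 - deriv g 0 * z = dslope (dslope g 0) 0 z * z ^ 2 := by
    rw [← h3]; linear_combination -z * h4
  rw [e, norm_mul, norm_pow]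
  gcongr

theorem dual_one_lt_one : dual 1 < 1 := by
  have h2 : Real.exp (-1) < 1 - Real.exp (-1) := by
    have h3 : Real.exp 1 * Real.exp (-1) = 1 := by rw [← Real.exp_add]; simp
    have h4 := Real.add_one_lt_exp (one_ne_zero (α := ℝ))
    nlinarith [Real.exp_pos (-1)]
  have h5 := Real.log_lt_log (Real.exp_pos _) h2
  rw [Real.log_exp] at h5
  rw [dual]
  linarith

/-- Taylor expansions of the factors of the integrand, uniform in the ordinate. -/
theorem exists_expansion : ∃ K : ℝ, 0 ≤ K ∧ ∀ t ∈ Icc (dual 1) 1, ∀ ζ : ℂ, ‖ζ‖ < 1 / 2 →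
    ‖base t ζ - (1 - curvature t * ζ ^ 2 / 2)‖ ≤ K * ‖ζ‖ ^ 3 ∧
    ‖amplitude t ζ - amplitude t 0‖ ≤ K * ‖ζ‖ ∧ ‖amplitude t ζ‖ ≤ K := by
  obtain ⟨M₁, hM₁⟩ := isCompact_domain.exists_bound_of_continuousOn continuousOn_baseDeriv
  obtain ⟨M₂, hM₂⟩ := isCompact_domain.exists_bound_of_continuousOn continuousOn_amplitude
  have hmem : ∀ t ∈ Icc (dual 1) 1, ∀ ζ : ℂ, ‖ζ‖ ≤ 1 / 2 → (t, ζ) ∈ domain :=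
    fun t ht ζ hζ => ⟨ht, by simpa using hζ⟩
  have h1 : (1 : ℝ) ∈ Icc (dual 1) 1 := ⟨dual_one_lt_one.le, le_rfl⟩
  have hM₁0 : 0 ≤ M₁ := (norm_nonneg _).trans (hM₁ (1, 0) (hmem 1 h1 0 (by simp)))
  have hM₂0 : 0 ≤ M₂ := (norm_nonneg _).trans (hM₂ (1, 0) (hmem 1 h1 0 (by simp)))
  set K₁ := 2 * (2 * M₁ / (1 / 2)) / (1 / 2)
  set K₂ := 2 * M₂ / (1 / 2) with hK₂
  have hK₁0 : 0 ≤ K₁ := by positivity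
  have hK₂0 : 0 ≤ K₂ := by positivity
  refine ⟨K₁ + K₂ + M₂, by positivity, fun t ht ζ hζ => ?_⟩
  have ht0 : 0 < t := (dual_pos one_pos).trans_le ht.1
  have hball : ∀ {w : ℂ}, w ∈ ball (0 : ℂ) (1 / 2) → ‖w‖ ≤ 1 / 2 := fun hw => by
    simpa using (mem_ball_zero_iff.1 hw).le
  refine ⟨?_, ?_, ?_⟩
  · have hd : ∀ w ∈ closedBall (0 : ℂ) ‖ζ‖, HasDerivWithinAt
        (fun w => base t w - (1 - curvature t * w ^ 2 / 2)) (baseDeriv t w + curvature t * w)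
        (closedBall (0 : ℂ) ‖ζ‖) w := by
      intro w hw
      have hw' : ‖w‖ ≤ 1 / 2 := (mem_closedBall_zero_iff.1 hw).trans hζ.le
      have h2 : HasDerivAt (fun w : ℂ => 1 - curvature t * w ^ 2 / 2) (-(curvature t * w)) w := by
        refine ((((hasDerivAt_pow 2 w).const_mul (curvature t : ℂ)).div_const 2).const_sub
          1).congr_deriv ?_
        push_cast; ring
      exact (((hasDerivAt_base ht0 hw').sub h2).congr_deriv (by ring)).hasDerivWithinAt
    have hb : ∀ w ∈ closedBall (0 : ℂ) ‖ζ‖, ‖baseDeriv t w + curvature t * w‖ ≤ K₁ * ‖ζ‖ ^ 2 := by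
      intro w hw
      have hw' : ‖w‖ ≤ ‖ζ‖ := mem_closedBall_zero_iff.1 hw
      have h3 := norm_sub_sub_deriv_le_of_bounded (g := baseDeriv t) (R := 1 / 2) (M := M₁)
        (fun w hw => (differentiableAt_baseDeriv ht0 (hball hw)).differentiableWithinAt)
        (fun w hw => hM₁ (t, w) (hmem t ht w (hball hw))) (mem_ball_zero_iff.2 (hw'.trans_lt hζ))
      rw [baseDeriv_zero ht0, (hasDerivAt_baseDeriv_zero ht0).deriv, sub_zero, neg_mul,
        sub_neg_eq_add] at h3
      exact h3.trans (by gcongr)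
    have h4 := (convex_closedBall (0 : ℂ) ‖ζ‖).norm_image_sub_le_of_norm_hasDerivWithin_le hd hb
      (mem_closedBall_self (norm_nonneg ζ)) (mem_closedBall_zero_iff.2 le_rfl)
    rw [base_zero ht0] at h4
    simp only [ne_eq, OfNat.ofNat_ne_zero, not_false_eq_true, zero_pow, mul_zero, zero_div,
      sub_zero, sub_self] at h4
    refine h4.trans ?_
    have h5 : 0 ≤ (K₂ + M₂) * ‖ζ‖ ^ 3 := by positivity
    calc K₁ * ‖ζ‖ ^ 2 * ‖ζ‖ ≤ K₁ * ‖ζ‖ ^ 2 * ‖ζ‖ + (K₂ + M₂) * ‖ζ‖ ^ 3 := by linarith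
      _ = _ := by ring
  · have h3 := norm_dslope_le_of_bounded (g := amplitude t) (R := 1 / 2) (M := M₂)
      (fun w hw => (differentiableAt_amplitude ht0 (hball hw)).differentiableWithinAt)
      (fun w hw => hM₂ (t, w) (hmem t ht w (hball hw))) (mem_ball_zero_iff.2 hζ)
    have h4 := sub_smul_dslope (amplitude t) 0 ζ
    rw [sub_zero, smul_eq_mul] at h4
    rw [← h4, norm_mul, mul_comm]
    gcongr
    linarith
  · have := hM₂ (t, ζ) (hmem t ht ζ hζ.le)
    simp only at this
    linarith

end

end ExcedanceAsymptotics

/-! ### Bounds on the circle of integration -/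

namespace ExcedanceAsymptotics

section

open Set Metric Filter Topology

theorem dual_mem_Icc {t : ℝ} (ht : t ∈ Icc (dual 1) 1) : dual t ∈ Icc (dual 1) 1 := by
  have h1 := dual_pos one_pos
  have ht0 : 0 < t := h1.trans_le ht.1
  refine ⟨dual_strictAntiOn.antitoneOn ht0 (mem_Ioi.2 one_pos) ht.2, ?_⟩
  have := dual_strictAntiOn.antitoneOn (mem_Ioi.2 h1) ht0 ht.1
  rwa [dual_dual one_pos] at this

theorem hessian_pos {t : ℝ} (ht : t ∈ Icc (dual 1) 1) : 0 < hessian t := by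
  have ht0 : 0 < t := (dual_pos one_pos).trans_le ht.1
  have hx := dual_mem_Icc ht
  have hx0 := dual_pos ht0
  have e1 : 0 < dual t * Real.exp (-dual t) := by positivity
  have e2 : 0 < t * Real.exp (-t) := by positivity
  rw [hessian]
  rcases ht.2.lt_or_eq with h | h
  · have h1 := mul_pos e1 (sub_pos.2 h)
    have h2 := mul_nonneg e2.le (sub_nonneg.2 hx.2)
    linarith
  · have h1 := mul_nonneg e1.le (sub_nonneg.2 ht.2)
    have h3 : dual t < 1 := by rw [h]; exact dual_one_lt_one
    have h2 := mul_pos e2 (sub_pos.2 h3)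
    linarith

theorem curvature_pos {t : ℝ} (ht : t ∈ Icc (dual 1) 1) : 0 < curvature t := by
  have ht0 : 0 < t := (dual_pos one_pos).trans_le ht.1
  have := dual_pos ht0
  have := hessian_pos ht
  rw [curvature]
  positivity

/-- The bounds that Laplace's method needs, by compactness. -/
theorem exists_curvature_bounds : ∃ τ₀ τ₁ : ℝ, 0 < τ₀ ∧
    ∀ t ∈ Icc (dual 1) 1, τ₀ ≤ curvature t ∧ curvature t ≤ τ₁ := by
  have hc : ContinuousOn curvature (Icc (dual 1) 1) :=
    curvature_continuousOn.mono fun t ht => (dual_pos one_pos).trans_le ht.1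
  have hne : (Icc (dual 1) 1).Nonempty := ⟨1, dual_one_lt_one.le, le_rfl⟩
  obtain ⟨a, ha, hmin⟩ := isCompact_Icc.exists_isMinOn hne hc
  obtain ⟨b, hb, hmax⟩ := isCompact_Icc.exists_isMaxOn hne hc
  exact ⟨curvature a, curvature b, curvature_pos ha, fun t ht => ⟨hmin ht, hmax ht⟩⟩

/-- Strict form of `|e ^ y - 1| ≤ e ^ |y| - 1`: the first two terms of the Taylor series lose a
definite amount when `y` is not a positive real. -/
theorem norm_exp_sub_one_le {t c θ : ℝ} (ht : 0 ≤ t) (ht1 : t ≤ 1) (hc : Real.cos θ ≤ c)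
    (hc1 : c ≤ 1) :
    ‖Complex.exp (t * Complex.exp (θ * Complex.I)) - 1‖ ≤
      Real.exp t - 1 - t ^ 2 * (1 - c) / 4 := by
  set y : ℂ := t * Complex.exp (θ * Complex.I) with hy
  have hny : ‖y‖ = t := by
    rw [hy, norm_mul, Complex.norm_exp_ofReal_mul_I, mul_one, Complex.norm_real,
      Real.norm_of_nonneg ht]
  have h1 := Complex.norm_exp_sub_sum_le_exp_norm_sub_sum y 3
  rw [hny] at h1
  simp only [Finset.sum_range_succ, Finset.sum_range_zero, Nat.factorial] at h1
  norm_num at h1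
  have h2 : ‖1 + y / 2‖ ≤ 1 + t / 2 - t * (1 - c) / 4 := by
    have hpos : 0 ≤ 1 + t / 2 - t * (1 - c) / 4 := by
      have := Real.neg_one_le_cos θ
      nlinarith
    refine abs_le_of_sq_le_sq' ?_ hpos |>.2
    rw [← Complex.normSq_eq_norm_sq, Complex.normSq_apply]
    have hre : (1 + y / 2).re = 1 + t * Real.cos θ / 2 := by
      rw [hy, Complex.exp_mul_I]
      simp [Complex.cos_ofReal_re, Complex.sin_ofReal_im]
    have him : (1 + y / 2).im = t * Real.sin θ / 2 := by
      rw [hy, Complex.exp_mul_I]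
      simp [Complex.cos_ofReal_im, Complex.sin_ofReal_re]
    rw [hre, him]
    have h3 := Real.sin_sq_add_cos_sq θ
    have h4 : t * Real.cos θ ≤ t * c := mul_le_mul_of_nonneg_left hc ht
    have h5 : 0 ≤ t * (1 - c) * (1 - t) := by
      have := mul_nonneg ht (sub_nonneg.2 hc1)
      exact mul_nonneg this (sub_nonneg.2 ht1)
    have h6 : 0 ≤ t * (1 - c) := mul_nonneg ht (sub_nonneg.2 hc1)
    have e : (1 + t * Real.cos θ / 2) * (1 + t * Real.cos θ / 2) +
        t * Real.sin θ / 2 * (t * Real.sin θ / 2) = 1 + t * Real.cos θ + t ^ 2 / 4 := by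
      linear_combination t ^ 2 / 4 * h3
    rw [e]
    nlinarith [sq_nonneg (t * (1 - c))]
  have e : Complex.exp y - 1 = (Complex.exp y - (1 + y + y ^ 2 / 2)) + y * (1 + y / 2) := by ring
  rw [e]
  refine (norm_add_le _ _).trans ?_
  rw [norm_mul, hny]
  have h7 := mul_le_mul_of_nonneg_left h2 ht
  linarith

theorem inv_pow_le_div {a : ℝ} (ha : 0 < a) {r : ℕ} (hr : 1 ≤ r) :
    1 / (1 + a) ^ r ≤ 1 / a / r := by
  have hr0 : (0 : ℝ) < r := by exact_mod_cast hr
  have h := one_add_mul_le_pow (a := a) (by linarith) r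
  rw [div_div]
  refine one_div_le_one_div_of_le (by positivity) ?_
  linarith

/-- Away from the positive real point of the circle the coefficients are exponentially smaller. -/
theorem exists_far_bound {δ : ℝ} (hδ : 0 < δ) (hδ1 : δ ≤ 1) : ∃ C : ℝ, 0 ≤ C ∧
    ∀ t ∈ Icc (dual 1) 1, ∀ θ : ℝ, δ ≤ |θ| → |θ| ≤ Real.pi → ∀ r : ℕ, 1 ≤ r →
      ‖xDeriv r (t * Complex.exp (θ * Complex.I))‖ / r.factorial * dual t ^ r ≤ C / r := by
  have hd := dual_pos one_pos
  set a := dual 1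
  have hpi := Real.pi_gt_three
  have hcos : Real.cos δ < 1 := by
    have := Real.cos_lt_cos_of_nonneg_of_le_pi le_rfl (by linarith) hδ
    rwa [Real.cos_zero] at this
  set γ := a ^ 3 * (1 - Real.cos δ) / 4 with hγ
  have hγ0 : 0 < γ := by have := sub_pos.2 hcos; positivity
  have he := Real.exp_pos 1
  have he3 := Real.exp_one_lt_three
  -- `e ^ ε = 1 + γ / 12`, so that enlarging the radius by `1 + ε` costs at most half of `γ`
  set ε := Real.log (1 + γ / 12) with hε
  have hε0 : 0 < ε := Real.log_pos (by linarith)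
  refine ⟨Real.exp (1 + ε) / (γ / 2) * (1 / ε), by positivity, ?_⟩
  intro t ht θ hθ hθ' r hr
  have ht0 : 0 < t := hd.trans_le ht.1
  have hx := dual_mem_Icc ht
  have hx0 := dual_pos ht0
  set x := dual t with hxdef
  have hc : Real.cos θ ≤ Real.cos δ := by
    rw [← Real.cos_abs θ]; exact Real.cos_le_cos_of_nonneg_of_le_pi hδ.le hθ' hθ
  have h1 := norm_exp_sub_one_le ht0.le ht.2 hc hcos.le
  set u := ‖Complex.exp (t * Complex.exp (θ * Complex.I)) - 1‖ with hu
  have hu0 : 0 ≤ u := norm_nonneg _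
  have hprod := exp_sub_one_mul_exp_dual_sub_one ht0
  rw [← hxdef] at hprod
  have hu2 : u ≤ 2 := by
    have h2 : Real.exp t ≤ Real.exp 1 := Real.exp_le_exp.2 ht.2
    have h3 : 0 ≤ t ^ 2 * (1 - Real.cos δ) / 4 := by have := sub_pos.2 hcos; positivity
    linarith
  have hxa : a ≤ Real.exp x - 1 := by
    have := Real.add_one_le_exp x; linarith [hx.1]
  have h4 : (Real.exp x - 1) * u ≤ 1 - γ := by
    have h5 := mul_le_mul_of_nonneg_left h1 (hd.le.trans hxa)
    have h6 : γ ≤ (Real.exp x - 1) * (t ^ 2 * (1 - Real.cos δ) / 4) := by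
      have h7 : a ^ 2 ≤ t ^ 2 := pow_le_pow_left₀ hd.le ht.1 2
      have h8 := sub_pos.2 hcos
      have h9 : 0 ≤ Real.exp x - 1 := hd.le.trans hxa
      calc γ = a * (a ^ 2 * (1 - Real.cos δ) / 4) := by rw [hγ]; ring
        _ ≤ _ := by gcongr
    linarith
  have hR : 0 < x * (1 + ε) := by positivity
  have h9 : (Real.exp (x * (1 + ε)) - 1) * u ≤ 1 - γ / 2 := by
    have h10 : Real.exp (x * (1 + ε)) ≤ Real.exp x * (1 + γ / 12) := by
      rw [← Real.exp_log (by linarith : 0 < 1 + γ / 12), ← hε, ← Real.exp_add]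
      refine Real.exp_le_exp.2 ?_
      have := mul_le_mul_of_nonneg_right hx.2 hε0.le
      linarith
    have h11 : Real.exp x ≤ 3 := (Real.exp_le_exp.2 hx.2).trans he3.le
    have h12 : Real.exp (x * (1 + ε)) - 1 ≤ (Real.exp x - 1) + γ / 4 := by
      have := mul_le_mul_of_nonneg_right h11 (by positivity : 0 ≤ γ / 12)
      linarith
    have h13 := mul_le_mul_of_nonneg_right h12 hu0
    have h14 := mul_le_mul_of_nonneg_left hu2 (by positivity : 0 ≤ γ / 4)
    linarith
  have h15 := norm_xDeriv_le r hR (by linarith : 1 - γ / 2 < 1) h9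
  have hf : (0 : ℝ) < r.factorial := by exact_mod_cast r.factorial_pos
  have h16 : Real.exp (x * (1 + ε)) ≤ Real.exp (1 + ε) := by
    refine Real.exp_le_exp.2 ?_
    have := mul_le_mul_of_nonneg_right hx.2 (by linarith : 0 ≤ 1 + ε)
    linarith
  calc ‖xDeriv r (t * Complex.exp (θ * Complex.I))‖ / r.factorial * x ^ r
      ≤ (r.factorial * (Real.exp (x * (1 + ε)) / (1 - (1 - γ / 2))) / (x * (1 + ε)) ^ r) /
          r.factorial * x ^ r := by gcongr
    _ = Real.exp (x * (1 + ε)) / (γ / 2) * (1 / (1 + ε) ^ r) := by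
        rw [mul_pow, sub_sub_cancel]; field_simp
    _ ≤ Real.exp (1 + ε) / (γ / 2) * (1 / ε / r) := by
        have := inv_pow_le_div hε0 hr
        gcongr
    _ = _ := by ring

/-- The pole approximation of the integrand near the positive real point of the circle. -/
theorem exists_near_bound (K : ℝ) : ∃ C : ℝ, 0 ≤ C ∧
    ∀ t ∈ Icc (dual 1) 1, ∀ θ : ℝ, |θ| ≤ 1 / 2 → 1 / 2 < ‖base t θ‖ → ‖amplitude t θ‖ ≤ K →
      ∀ r s : ℕ, 1 ≤ r → (s : ℝ) = r * slope t →
      ‖xDeriv r (t * Complex.exp (θ * Complex.I)) / r.factorial *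
          Complex.exp (-(s * θ * Complex.I)) * dual t ^ r - amplitude t θ * base t θ ^ r‖ ≤
        C / r := by
  obtain ⟨M, hM⟩ := exists_norm_xDeriv_sub_le
  refine ⟨2 * |K| * |M|, by positivity, ?_⟩
  intro t ht θ hθ hb hA r s hr hs
  have ht0 : 0 < t := (dual_pos one_pos).trans_le ht.1
  have hx := dual_mem_Icc ht
  have hx0 := dual_pos ht0
  have hr0 : (0 : ℝ) < r := by exact_mod_cast hr
  have hre : 0 < ((t : ℂ) * Complex.exp (θ * Complex.I)).re :=
    mul_exp_I_re_pos ht0 (by simpa using hθ)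
  set y : ℂ := t * Complex.exp (θ * Complex.I) with hy
  set X := cdual y with hX
  have hXne : X ≠ 0 := cdual_ne_zero hre
  have hph : ‖Complex.exp (-(slope t * θ * Complex.I))‖ = 1 := by
    rw [show -((slope t : ℂ) * θ * Complex.I) = ((-(slope t * θ) : ℝ) : ℂ) * Complex.I by
      push_cast; ring]
    exact Complex.norm_exp_ofReal_mul_I _
  have hbX : ‖base t θ‖ * ‖X‖ = dual t := by
    rw [base, ← hy, ← hX, norm_div, norm_mul, hph, mul_one, Complex.norm_real,
      Real.norm_of_nonneg hx0.le]
    exact div_mul_cancel₀ _ (norm_ne_zero_iff.2 hXne)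
  have hXpos : 0 < ‖X‖ := norm_pos_iff.2 hXne
  have hX2 : ‖X‖ < 2 := by
    have := mul_lt_mul_of_pos_right hb hXpos
    linarith [hx.2]
  have h := hM r y X hXne hX2 (exp_neg_cdual hre)
  have hphase : Complex.exp (-(s * θ * Complex.I)) =
      Complex.exp (-(slope t * θ * Complex.I)) ^ r := by
    rw [← Complex.exp_nat_mul]
    congr 1
    have : (s : ℂ) = r * slope t := by exact_mod_cast hs
    rw [this]; ring
  have e : xDeriv r y / r.factorial * Complex.exp (-(s * θ * Complex.I)) * dual t ^ r -
      amplitude t θ * base t θ ^ r =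
      (xDeriv r y / r.factorial - Complex.exp (X - y) / X ^ (r + 1)) *
        (Complex.exp (-(slope t * θ * Complex.I)) * dual t) ^ r := by
    rw [hphase, amplitude, base, ← hy, ← hX, div_pow]
    field_simp
    ring
  have hamp : ‖Complex.exp (X - y)‖ ≤ 2 * |K| := by
    have h1 : ‖Complex.exp (X - y)‖ = ‖amplitude t θ‖ * ‖X‖ := by
      rw [amplitude, ← hy, ← hX, norm_div]
      exact (div_mul_cancel₀ _ hXpos.ne').symm
    rw [h1, mul_comm]
    have := hA.trans (le_abs_self K)
    gcongr
  have h2 := inv_pow_le_div one_pos hr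
  norm_num at h2
  rw [e, norm_mul, norm_pow, norm_mul, hph, one_mul, Complex.norm_real,
    Real.norm_of_nonneg hx0.le]
  have h3 : dual t ^ r ≤ 1 := pow_le_one₀ hx0.le hx.2
  calc _ ≤ ‖Complex.exp (X - y)‖ * M / 2 ^ r * 1 :=
        mul_le_mul h h3 (by positivity) ((norm_nonneg _).trans h)
    _ ≤ 2 * |K| * |M| * (2 ^ r)⁻¹ := by
        rw [mul_one, div_eq_mul_inv]
        refine mul_le_mul_of_nonneg_right ?_ (by positivity)
        calc _ ≤ ‖Complex.exp (X - y)‖ * |M| := by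
              have := le_abs_self M
              gcongr
          _ ≤ _ := by gcongr
    _ ≤ 2 * |K| * |M| * (r : ℝ)⁻¹ := by gcongr
    _ = _ := by rw [div_eq_mul_inv]

end

end ExcedanceAsymptotics

/-! ### The asymptotic formula -/

namespace ExcedanceAsymptotics

section

open Set Metric Filter Topology

theorem amplitude_zero {t : ℝ} (ht : 0 < t) :
    amplitude t 0 = (Real.exp (dual t - t) / dual t : ℝ) := by
  simp [amplitude, cdual_ofReal ht]

/-- The asymptotic formula in the normalisation of the saddle point integral. -/
theorem exists_bracket_bound : ∃ C : ℝ, 0 ≤ C ∧ ∀ t ∈ Icc (dual 1) 1, ∀ r s : ℕ, 1 ≤ r →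
    (s : ℝ) = r * slope t →
    |(Excedance.bracket (Excedance.baWord (r - 1) s) : ℝ) / (r.factorial * s.factorial) *
        (dual t ^ r * t ^ s) -
      Real.exp (dual t - t) / dual t * Real.sqrt (2 * Real.pi / (r * curvature t)) /
        (2 * Real.pi)| ≤ C / r := by
  obtain ⟨K, hK0, hK⟩ := exists_expansion
  obtain ⟨τ₀, τ₁, hτ₀, hτ⟩ := exists_curvature_bounds
  have hτ₁ : 0 < τ₁ := by
    have := hτ 1 ⟨dual_one_lt_one.le, le_rfl⟩
    linarith [this.1, this.2]
  -- `δ` is small enough for the cubic error to stay below half of the quadratic term and for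
  -- `|base|` to stay above `1 / 2`, which keeps the pole inside the disc of radius `2`
  obtain ⟨δ, hδ, hδ2, hKδ, hτδ⟩ : ∃ δ : ℝ, 0 < δ ∧ δ ≤ 1 / 4 ∧ K * δ ≤ τ₀ / 4 ∧
      τ₁ * δ ≤ 1 / 4 := by
    refine ⟨min (1 / 4) (min (τ₀ / (4 * (K + 1))) (1 / (4 * τ₁))), by positivity,
      min_le_left _ _, ?_, ?_⟩
    · have h1 : min (1 / 4) (min (τ₀ / (4 * (K + 1))) (1 / (4 * τ₁))) ≤ τ₀ / (4 * (K + 1)) :=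
        (min_le_right _ _).trans (min_le_left _ _)
      calc _ ≤ (K + 1) * (τ₀ / (4 * (K + 1))) := by
            refine mul_le_mul (by linarith) h1 (by positivity) (by positivity)
        _ = τ₀ / 4 := by field_simp
    · have h1 : min (1 / 4) (min (τ₀ / (4 * (K + 1))) (1 / (4 * τ₁))) ≤ 1 / (4 * τ₁) :=
        (min_le_right _ _).trans (min_le_right _ _)
      calc _ ≤ τ₁ * (1 / (4 * τ₁)) := by gcongr
        _ = 1 / 4 := by field_simp
  have hτδ2 : τ₁ * δ ^ 2 ≤ 1 / 4 := by
    calc τ₁ * δ ^ 2 = τ₁ * δ * δ := by ring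
      _ ≤ 1 / 4 * 1 := by gcongr; linarith
      _ = 1 / 4 := by ring
  obtain ⟨C₁, hC₁, hlap⟩ := exists_laplace_bound hδ (by linarith) hK0 hτ₀ hKδ
    (by linarith : τ₁ * δ ^ 2 ≤ 2)
  obtain ⟨C₂, hC₂, hfar⟩ := exists_far_bound hδ (by linarith)
  obtain ⟨C₃, hC₃, hnear⟩ := exists_near_bound K
  have hpi := Real.pi_pos
  refine ⟨(C₁ + 2 * Real.pi * (C₂ + C₃)) / (2 * Real.pi), by positivity, ?_⟩
  intro t ht r s hr hs
  have ht0 : 0 < t := (dual_pos one_pos).trans_le ht.1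
  have hx0 := dual_pos ht0
  have hr0 : (0 : ℝ) < r := by exact_mod_cast hr
  have hnorm : ∀ θ : ℝ, ‖(θ : ℂ)‖ = |θ| := fun θ => by simp
  have hA : ∀ θ : ℝ, |θ| ≤ δ →
      ‖base t θ - (1 - curvature t * θ ^ 2 / 2 : ℝ)‖ ≤ K * |θ| ^ 3 := by
    intro θ hθ
    have := (hK t ht θ (by rw [hnorm]; linarith)).1
    rw [hnorm] at this
    push_cast
    exact this
  have hP : ∀ θ : ℝ, |θ| ≤ δ → ‖amplitude t θ - amplitude t 0‖ ≤ K * |θ| := by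
    intro θ hθ
    have := (hK t ht θ (by rw [hnorm]; linarith)).2.1
    rwa [hnorm] at this
  set Φ : ℝ → ℂ := fun θ => xDeriv r (t * Complex.exp (θ * Complex.I)) / r.factorial *
    Complex.exp (-(s * θ * Complex.I)) * dual t ^ r with hΦ
  have hΦc : Continuous Φ := by
    have h1 : Continuous fun θ : ℝ => xDeriv r (t * Complex.exp (θ * Complex.I)) :=
      (differentiable_xDeriv r).continuous.comp (by fun_prop)
    fun_prop
  have hn : ∀ θ : ℝ, |θ| ≤ δ → ‖Φ θ - amplitude t θ * base t θ ^ r‖ ≤ (C₂ + C₃) / r := by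
    intro θ hθ
    refine (hnear t ht θ (by linarith) ?_ (hK t ht θ (by rw [hnorm]; linarith)).2.2 r s hr
      hs).trans (by gcongr; linarith)
    have h1 := hA θ hθ
    have h2 := norm_sub_norm_le ((1 - curvature t * θ ^ 2 / 2 : ℝ) : ℂ) (base t θ)
    rw [norm_sub_rev, Complex.norm_real] at h2
    have h3 := Real.le_norm_self (1 - curvature t * θ ^ 2 / 2)
    have hθ2 : θ ^ 2 ≤ δ ^ 2 := by rw [← sq_abs θ]; gcongr
    have h4 : curvature t * θ ^ 2 ≤ τ₁ * δ ^ 2 :=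
      mul_le_mul (hτ t ht).2 hθ2 (sq_nonneg θ) hτ₁.le
    have h5 : K * |θ| ^ 3 ≤ 1 / 16 := by
      have h6 : τ₀ ≤ τ₁ := (hτ t ht).1.trans (hτ t ht).2
      calc K * |θ| ^ 3 ≤ K * δ ^ 3 := by gcongr
        _ = K * δ * δ ^ 2 := by ring
        _ ≤ τ₁ / 4 * δ ^ 2 := by gcongr; linarith
        _ ≤ 1 / 16 := by linarith
    linarith
  have hf : ∀ θ : ℝ, δ ≤ |θ| → |θ| ≤ Real.pi → ‖Φ θ‖ ≤ (C₂ + C₃) / r := by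
    intro θ hθ hθ'
    have h1 := hfar t ht θ hθ hθ' r hr
    have h2 : ‖Complex.exp (-(s * θ * Complex.I))‖ = 1 := by
      rw [show -((s : ℂ) * θ * Complex.I) = ((-(s * θ) : ℝ) : ℂ) * Complex.I by push_cast; ring]
      exact Complex.norm_exp_ofReal_mul_I _
    rw [hΦ]
    simp only [norm_mul, h2, mul_one, norm_pow, norm_div, Complex.norm_natCast, Complex.norm_real,
      Real.norm_of_nonneg hx0.le]
    exact h1.trans (by gcongr; linarith)
  have hP₀ : ‖amplitude t 0‖ ≤ K := (hK t ht 0 (by simp)).2.2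
  have h := hlap Φ (fun θ => base t θ) (fun θ => amplitude t θ) (amplitude t 0) (curvature t)
    ((C₂ + C₃) / r) r hr hΦc (hτ t ht).1 (hτ t ht).2 (by positivity) hP₀ hA hP hn hf
  have hint : ∫ θ in (-Real.pi)..Real.pi, Φ θ =
      ((2 * Real.pi * ((Excedance.bracket (Excedance.baWord (r - 1) s) : ℝ) /
        (r.factorial * s.factorial) * (dual t ^ r * t ^ s)) : ℝ) : ℂ) := by
    have h1 := iteratedDeriv_eq_integral (differentiable_xDeriv r) s ht0
    rw [iteratedDeriv_xDeriv r s hr] at h1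
    have hpi' : (Real.pi : ℂ) ≠ 0 := by exact_mod_cast hpi.ne'
    have ht' : (t : ℂ) ≠ 0 := by exact_mod_cast ht0.ne'
    have hrf : (r.factorial : ℂ) ≠ 0 := by exact_mod_cast r.factorial_ne_zero
    have hsf : (s.factorial : ℂ) ≠ 0 := by exact_mod_cast s.factorial_ne_zero
    have e : ∀ θ : ℝ, Φ θ = (dual t ^ r * t ^ s / r.factorial : ℂ) *
        (xDeriv r (t * Complex.exp (θ * Complex.I)) * Complex.exp (-(s * θ * Complex.I)) /
          t ^ s) := by
      intro θ; rw [hΦ]; field_simp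
    simp only [e]
    rw [intervalIntegral.integral_const_mul]
    push_cast
    generalize (∫ θ in (-Real.pi)..Real.pi, xDeriv r (t * Complex.exp (θ * Complex.I)) *
      Complex.exp (-(s * θ * Complex.I)) / (t : ℂ) ^ s) = J at *
    rw [eq_comm, inv_mul_eq_iff_eq_mul₀ (by simp [hpi'])] at h1
    rw [h1]
    field_simp
  rw [hint, amplitude_zero ht0, ← Complex.ofReal_mul, ← Complex.ofReal_sub, Complex.norm_real,
    Real.norm_eq_abs] at h
  set N := (Excedance.bracket (Excedance.baWord (r - 1) s) : ℝ) / (r.factorial * s.factorial) *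
    (dual t ^ r * t ^ s)
  set G := Real.exp (dual t - t) / dual t * Real.sqrt (2 * Real.pi / (r * curvature t))
  have e : N - G / (2 * Real.pi) = (2 * Real.pi * N - G) / (2 * Real.pi) := by
    field_simp
  rw [e, abs_div, abs_of_pos (by positivity : 0 < 2 * Real.pi), div_le_iff₀ (by positivity)]
  refine h.trans (le_of_eq ?_)
  field_simp

/-- The two normalisations of the leading term agree. -/
theorem main_term_eq {t : ℝ} (ht : t ∈ Icc (dual 1) 1) {r s : ℕ} (hr : 1 ≤ r)
    (hs : (s : ℝ) = r * slope t) :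
    Real.sqrt (t * Real.exp (-t) / (s * Excedance.Q (dual t) t)) =
        1 / Real.sqrt (r * (t * Real.exp (-t) * hessian t)) ∧
      Real.exp (dual t - t) / dual t * Real.sqrt (2 * Real.pi / (r * curvature t)) /
        (2 * Real.pi) =
      Real.exp (-t) * (1 / Real.sqrt (2 * Real.pi)) *
        (1 / Real.sqrt (r * (t * Real.exp (-t) * hessian t))) := by
  have ht0 : 0 < t := (dual_pos one_pos).trans_le ht.1
  have hx0 := dual_pos ht0
  have hH := hessian_pos ht
  have hr0 : (0 : ℝ) < r := by exact_mod_cast hr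
  have hpi := Real.pi_pos
  have hex := exp_neg_dual ht0
  have hQ : Excedance.Q (dual t) t = dual t * t * (Real.exp (-dual t) * Real.exp (-t)) *
      hessian t := by
    rw [Excedance.Q, hessian, ← Real.exp_add, ← sub_eq_add_neg]; ring
  have hp := Real.exp_pos (-dual t)
  have hq := Real.exp_pos (-t)
  constructor
  · rw [← Real.sqrt_one, ← Real.sqrt_div zero_le_one]
    congr 1
    rw [hQ, hs, slope, ← hex]
    field_simp
  · have e1 : Real.exp (dual t - t) = Real.exp (-t) / Real.exp (-dual t) := by
      rw [← Real.exp_sub]; congr 1; ring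
    have e2 : 2 * Real.pi / (r * curvature t) =
        (dual t * Real.exp (-dual t)) ^ 2 * (2 * Real.pi / (r * (t * Real.exp (-t) * hessian t))) := by
      rw [curvature]; field_simp
    rw [e1, e2, Real.sqrt_mul (by positivity), Real.sqrt_sq (by positivity),
      Real.sqrt_div (by positivity)]
    have h2 : Real.sqrt (2 * Real.pi) ^ 2 = 2 * Real.pi := Real.sq_sqrt (by positivity)
    have h3 : 0 < Real.sqrt (2 * Real.pi) := by positivity
    have h4 : 0 < Real.sqrt (r * (t * Real.exp (-t) * hessian t)) := by positivity
    rw [← h2, Real.sqrt_sq h3.le]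
    field_simp

theorem hessian_le {t : ℝ} (ht : t ∈ Icc (dual 1) 1) : t * Real.exp (-t) * hessian t ≤ 2 := by
  have ht0 : 0 < t := (dual_pos one_pos).trans_le ht.1
  have hx0 := dual_pos ht0
  have hx := (dual_mem_Icc ht).2
  have h1 : ∀ u : ℝ, 0 < u → u ≤ 1 → u * Real.exp (-u) ≤ 1 := fun u h h' =>
    mul_le_one₀ h' (Real.exp_nonneg _) (Real.exp_le_one_iff.2 (by linarith))
  have h2 := h1 t ht0 ht.2
  have h3 := h1 _ hx0 hx
  have h4 : hessian t ≤ 2 := by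
    have h5 := mul_le_one₀ h3 (sub_nonneg.2 ht.2) (by linarith)
    have h6 := mul_le_one₀ h2 (sub_nonneg.2 hx) (by linarith)
    rw [hessian]
    linarith
  calc _ ≤ 1 * hessian t := mul_le_mul_of_nonneg_right h2 (hessian_pos ht).le
    _ ≤ 2 := by linarith

end

end ExcedanceAsymptotics

open ExcedanceAsymptotics

theorem theorem1p2 :
    Set.BijOn Excedance.f (Set.Ioi 0) (Set.Ioi 0) ∧
    ∃ (C : ℝ) (N : ℕ), ∀ r s : ℕ, N ≤ r → N ≤ s →
      (r, s) ∈ Excedance.sector Excedance.eps0 →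
      ∃ E : ℝ, |E| ≤ C * (s : ℝ) ^ (-(1 / 2) : ℝ) ∧
        (Excedance.bracket (Excedance.baWord (r - 1) s) : ℝ) =
          (s.factorial : ℝ) * (r.factorial : ℝ) *
            (Real.exp (-Excedance.y r s) + E) *
            (1 / Real.sqrt (2 * Real.pi)) *
            Excedance.x r s ^ (-(r : ℤ)) * Excedance.y r s ^ (-(s : ℤ)) *
            Real.sqrt (Excedance.y r s * Real.exp (-Excedance.y r s) /
              ((s : ℝ) * Excedance.Q (Excedance.x r s) (Excedance.y r s))) := by
  refine ⟨f_bijOn, ?_⟩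
  obtain ⟨C, hC0, hC⟩ := exists_bracket_bound
  have hε : 0 < Excedance.eps0 := f_one ▸ f_pos one_pos
  have hpi := Real.pi_pos
  refine ⟨C * Real.sqrt (2 * Real.pi) * Real.sqrt 2 * Real.sqrt (1 / Excedance.eps0), 1, ?_⟩
  intro r s hr hs hsec
  obtain ⟨ht, hx, -, hfx⟩ := sector_spec hsec
  obtain ⟨-, -, -, hsr⟩ := hsec
  simp only at hsr
  set t := Excedance.y r s
  have ht0 : 0 < t := (dual_pos one_pos).trans_le ht.1
  have hx0 := dual_pos ht0
  have hr0 : (0 : ℝ) < r := by exact_mod_cast hr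
  have hs0 : (0 : ℝ) < s := by exact_mod_cast hs
  have hslope : (s : ℝ) = r * slope t := by
    rw [← f_dual_eq_slope ht0, ← hx, hfx]; field_simp
  obtain ⟨hS, hG⟩ := main_term_eq ht hr hslope
  have h := hC t ht r s hr hslope
  rw [hx, hS]
  rw [hG] at h
  have hW0 : 0 < t * Real.exp (-t) * hessian t := by
    have := hessian_pos ht
    positivity
  have hW2 := hessian_le ht
  set W := t * Real.exp (-t) * hessian t
  set B := (Excedance.bracket (Excedance.baWord (r - 1) s) : ℝ)
  have hrf : (0 : ℝ) < r.factorial := by exact_mod_cast r.factorial_pos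
  have hsf : (0 : ℝ) < s.factorial := by exact_mod_cast s.factorial_pos
  have h2π : 0 < Real.sqrt (2 * Real.pi) := by positivity
  have hrW : 0 < Real.sqrt (r * W) := by positivity
  set c := Real.sqrt (2 * Real.pi) * Real.sqrt (r * W) with hc
  have hc0 : 0 < c := by positivity
  -- the error is the absolute error `O(1 / r)` divided by the factor `1 / c`, of order `r ^ (-1/2)`
  refine ⟨(B / (r.factorial * s.factorial) * (dual t ^ r * t ^ s) -
    Real.exp (-t) * (1 / Real.sqrt (2 * Real.pi)) * (1 / Real.sqrt (r * W))) * c, ?_, ?_⟩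
  · rw [abs_mul, abs_of_pos hc0]
    have h1 : c ≤ Real.sqrt (2 * Real.pi) * (Real.sqrt r * Real.sqrt 2) := by
      rw [hc, Real.sqrt_mul hr0.le]
      gcongr
    have h2 : Real.sqrt s ≤ Real.sqrt r * Real.sqrt (1 / Excedance.eps0) := by
      rw [← Real.sqrt_mul hr0.le]
      refine Real.sqrt_le_sqrt ?_
      rw [div_le_iff₀ hr0] at hsr
      linarith
    have hsr0 : 0 < Real.sqrt r := Real.sqrt_pos.2 hr0
    have hss0 : 0 < Real.sqrt s := Real.sqrt_pos.2 hs0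
    have h3 : Real.sqrt r / r ≤ Real.sqrt (1 / Excedance.eps0) * (Real.sqrt s)⁻¹ := by
      rw [Real.sqrt_div_self', ← div_eq_mul_inv, div_le_div_iff₀ hsr0 hss0]
      linarith
    rw [Real.rpow_neg hs0.le, ← Real.sqrt_eq_rpow]
    calc _ ≤ C / r * (Real.sqrt (2 * Real.pi) * (Real.sqrt r * Real.sqrt 2)) :=
          mul_le_mul h h1 hc0.le (by positivity)
      _ = C * Real.sqrt (2 * Real.pi) * Real.sqrt 2 * (Real.sqrt r / r) := by ring
      _ ≤ C * Real.sqrt (2 * Real.pi) * Real.sqrt 2 *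
          (Real.sqrt (1 / Excedance.eps0) * (Real.sqrt s)⁻¹) := by gcongr
      _ = _ := by ring
  · rw [zpow_neg, zpow_neg, zpow_natCast, zpow_natCast, hc]
    field_simp
    ring
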